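/- A basis $B$ of a finite-dimensional complex Hopf algebra $H$ is called *positive* if all structure constants of $H$ (multiplication, unit, comultiplication, counit, antipode) with respect to $B$ are non-negative. A quasi-triangular structure on $H$ is an invertible $R\in H\otimes H$ with $\tau\Delta(a)=R\Delta(a)R^{-1}$ for all $a\in H$, $(\Delta\otimes \mathrm{id})R=R_{13}R_{23}$, $(\mathrm{id}\otimes\Delta)R=R_{13}R_{12}$ and $(\varepsilon\otimes \mathrm{id})R=(\mathrm{id}\otimes\varepsilon)R=1$, where $\tau(a\otimes b)=b\otimes a$; it is *positive* with respect to $B$ if its coefficients in the basis $B\otimes B$ are non-negative. Let $G=G_+G_-$ be a unique factorization of a finite group into two subgroups; write $g=g_+g_-=\bar g_-\bar g_+$ with $g_+,\bar g_+\in G_+$ and $g_-,\bar g_-\in G_-$. For $u\in G_+$ and $x\in G_-$, let ${}^{u}x$ be the $G_-$-component of $ux$ with respect to the factorization $G=G_-G_+$, and let $x^{u}$ be the $G_-$-component of $xu$ with respect to $G=G_+G_-$. Let $H(G;G_+,G_-)$ be the Hopf algebra with basis $\{g\}$, $g\in G$, and $$\{g\}\{h\}=\delta_{\bar g_+,h_+}\{gh_-\},\quad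 1=\sum_{u\in G_+}\{u\},\quad \Delta\{g\}=\sum_{h\in G_+}\{g_+h^{-1}({}^{h}g_-)\}\otimes\{hg_-\},\quad \varepsilon\{g\}=\delta_{g_+,e},\quad S\{g\}=\{g^{-1}\}.$$ A positive (with respect to the basis $G$) quasi-triangular structure $R$ on $H(G;G_+,G_-)$ is called *normal* if there is a pair of group homomorphisms $\xi,\eta:G_+\to G_-$ with $\xi$ trivial ($\xi(u)=e$ for all $u\in G_+$), such that $G_+'=\{u\xi(u^{-1}):u\in G_+\}$ and $G_+''=\{\eta(u^{-1})u:u\in G_+\}$ are normal subgroups of $G$, $u\xi(u^{-1})\mapsto\eta(u)u^{-1}$ is a group isomorphism $G_+'\to G_+''$, and $$R=\sum_{u,v\in G_+}\{u(\eta(v)^{u})^{-1}\}\otimes\{v\xi(u)\}.$$ **Theorem.** Let $H$ be a finite-dimensional complex Hopf algebra with a positive basis $B$, and let $R$ be a quasi-triangular structure on $H$ that is positive with respect to $B$. Then $(H,R)$ is quasi-isomorphic to a normal pair: there are a unique factorization $G=G_+G_-$ of a finite group, a normal positive quasi-triangular structure $R'$ on $H'=H(G;G_+,G_-)$, an isomorphism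 of algebras $\phi:H'\to H$ with $\varepsilon\circ\phi=\varepsilon$, and an invertible element (twist) $T\in H\otimes H$ such that $$(\phi\otimes\phi)\Delta(a)=T\,\Delta(\phi(a))\,T^{-1}\ (a\in H'),\qquad (T\otimes1)(\Delta\otimes \mathrm{id})T=(1\otimes T)(\mathrm{id}\otimes\Delta)T,$$ $$(\varepsilon\otimes \mathrm{id})T=(\mathrm{id}\otimes\varepsilon)T=1,\qquad (\phi\otimes\phi)R'=\tau(T)\,R\,T^{-1}.$$ -/

import Mathlib

open scoped TensorProduct ComplexOrder

namespace PositiveHopf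

section Factorization

variable {G : Type*} [Group G] {P N : Subgroup G} (hPN : P.IsComplement' N)

/-- For a unique factorization `G = P N`, the component `g₊ ∈ P` in `g = g₊ g₋`. -/
noncomputable def plus (g : G) : G := (Subgroup.IsComplement.equiv hPN g).1

/-- For a unique factorization `G = P N`, the component `g₋ ∈ N` in `g = g₊ g₋`. -/
noncomputable def minus (g : G) : G := (Subgroup.IsComplement.equiv hPN g).2

/-- The component in `P` of `g` for the opposite factorization `g = ḡ₋ ḡ₊`. -/
noncomputable def barPlus (g : G) : G := (plus hPN g⁻¹)⁻¹

/-- The component in `N` of `g` for the opposite factorization `g = ḡ₋ ḡ₊`. -/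
noncomputable def barMinus (g : G) : G := (minus hPN g⁻¹)⁻¹

lemma plus_mem (g : G) : plus hPN g ∈ P := (Subgroup.IsComplement.equiv hPN g).1.2

lemma minus_mem (g : G) : minus hPN g ∈ N := (Subgroup.IsComplement.equiv hPN g).2.2

lemma barPlus_mem (g : G) : barPlus hPN g ∈ P := P.inv_mem (plus_mem hPN _)

lemma barMinus_mem (g : G) : barMinus hPN g ∈ N := N.inv_mem (minus_mem hPN _)

lemma plus_mul_minus (g : G) : plus hPN g * minus hPN g = g :=
  Subgroup.IsComplement.equiv_fst_mul_equiv_snd hPN g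

lemma barMinus_mul_barPlus (g : G) : barMinus hPN g * barPlus hPN g = g := by
  rw [barMinus, barPlus, ← mul_inv_rev, plus_mul_minus, inv_inv]

lemma plus_minus_unique {u x : G} (hu : u ∈ P) (hx : x ∈ N) :
    plus hPN (u * x) = u ∧ minus hPN (u * x) = x := by
  have h : Subgroup.IsComplement.equiv hPN (u * x) = (⟨u, hu⟩, ⟨x, hx⟩) := by
    rw [← Equiv.eq_symm_apply]
    rfl
  simp [plus, minus, h]

lemma plus_mul_of_mem {x : G} (g : G) (hx : x ∈ N) : plus hPN (g * x) = plus hPN g := by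
  conv_lhs => rw [← plus_mul_minus hPN g, mul_assoc]
  exact (plus_minus_unique hPN (plus_mem hPN g) (N.mul_mem (minus_mem hPN g) hx)).1

lemma minus_mul_of_mem {x : G} (g : G) (hx : x ∈ N) : minus hPN (g * x) = minus hPN g * x := by
  conv_lhs => rw [← plus_mul_minus hPN g, mul_assoc]
  exact (plus_minus_unique hPN (plus_mem hPN g) (N.mul_mem (minus_mem hPN g) hx)).2

lemma plus_of_mem_mul {u : G} (hu : u ∈ P) (g : G) : plus hPN (u * g) = u * plus hPN g := by
  conv_lhs => rw [← plus_mul_minus hPN g, ← mul_assoc]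
  exact (plus_minus_unique hPN (P.mul_mem hu (plus_mem hPN g)) (minus_mem hPN g)).1

lemma minus_of_mem_mul {u : G} (hu : u ∈ P) (g : G) : minus hPN (u * g) = minus hPN g := by
  conv_lhs => rw [← plus_mul_minus hPN g, ← mul_assoc]
  exact (plus_minus_unique hPN (P.mul_mem hu (plus_mem hPN g)) (minus_mem hPN g)).2

lemma barPlus_of_mem_mul {x : G} (hx : x ∈ N) (g : G) :
    barPlus hPN (x * g) = barPlus hPN g := by
  rw [barPlus, mul_inv_rev, plus_mul_of_mem hPN _ (N.inv_mem hx), barPlus]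

lemma barPlus_mul_of_mem (g : G) {u : G} (hu : u ∈ P) :
    barPlus hPN (g * u) = barPlus hPN g * u := by
  rw [barPlus, mul_inv_rev, plus_of_mem_mul hPN (P.inv_mem hu), barPlus, mul_inv_rev, inv_inv]

lemma plus_one : plus hPN 1 = 1 := by
  simpa using (plus_minus_unique hPN P.one_mem N.one_mem).1

lemma minus_one : minus hPN 1 = 1 := by
  simpa using (plus_minus_unique hPN P.one_mem N.one_mem).2

lemma barPlus_one : barPlus hPN 1 = 1 := by simp [barPlus, plus_one]

lemma plus_of_mem {u : G} (hu : u ∈ P) : plus hPN u = u := by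
  simpa [plus_one] using plus_of_mem_mul hPN hu 1

lemma minus_of_mem {u : G} (hu : u ∈ P) : minus hPN u = 1 := by
  simpa [minus_one] using minus_of_mem_mul hPN hu 1

lemma barPlus_of_mem {u : G} (hu : u ∈ P) : barPlus hPN u = u := by
  simpa [barPlus_one] using barPlus_mul_of_mem hPN 1 hu

lemma barPlus_of_mem_minus {x : G} (hx : x ∈ N) : barPlus hPN x = 1 := by
  simpa [barPlus_one] using barPlus_of_mem_mul hPN hx 1

lemma plus_of_mem_minus {x : G} (hx : x ∈ N) : plus hPN x = 1 := by
  simpa [plus_one] using plus_mul_of_mem hPN 1 hx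

lemma minus_of_mem_minus {x : G} (hx : x ∈ N) : minus hPN x = x := by
  simpa [minus_one] using minus_mul_of_mem hPN 1 hx

lemma barPlus_barPlus_mul (g k : G) : barPlus hPN (barPlus hPN g * k) = barPlus hPN (g * k) := by
  conv_rhs => rw [← barMinus_mul_barPlus hPN g, mul_assoc, barPlus_of_mem_mul hPN (barMinus_mem hPN g)]

lemma barMinus_eq (g : G) : barMinus hPN g = g * (barPlus hPN g)⁻¹ :=
  eq_mul_inv_of_mul_eq (barMinus_mul_barPlus hPN g)

lemma minus_eq (g : G) : minus hPN g = (plus hPN g)⁻¹ * g :=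
  eq_inv_mul_of_mul_eq (plus_mul_minus hPN g)

lemma plus_mul_barPlus_inv (g h : G) (hh : h ∈ P) :
    plus hPN (g * (barPlus hPN (h * minus hPN g))⁻¹) = plus hPN g * h⁻¹ := by
  have : g * (barPlus hPN (h * minus hPN g))⁻¹ =
      (plus hPN g * h⁻¹) * barMinus hPN (h * minus hPN g) := by
    rw [barMinus_eq]
    generalize barPlus hPN (h * minus hPN g) = b
    rw [minus_eq]
    group
  rw [this]
  exact (plus_minus_unique hPN (P.mul_mem (plus_mem hPN g) (P.inv_mem hh)) (barMinus_mem hPN _)).1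

lemma plus_mul_inv_mul_barMinus (g h : G) : plus hPN g * h⁻¹ * barMinus hPN (h * minus hPN g) =
    g * (barPlus hPN (h * minus hPN g))⁻¹ := by
  rw [barMinus_eq]
  generalize barPlus hPN (h * minus hPN g) = b
  rw [minus_eq]
  group

lemma minus_mul_barPlus_inv (g h : G) (hh : h ∈ P) :
    minus hPN (g * (barPlus hPN (h * minus hPN g))⁻¹) =
      h * minus hPN g * (barPlus hPN (h * minus hPN g))⁻¹ := by
  rw [minus_eq, plus_mul_barPlus_inv hPN g h hh]
  generalize barPlus hPN (h * minus hPN g) = b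
  rw [minus_eq]
  group

lemma barPlus_eq_one_iff (g : G) : barPlus hPN g = 1 ↔ plus hPN g = 1 := by
  constructor
  · intro hc
    have := barMinus_mul_barPlus hPN g
    rw [hc, mul_one] at this
    rw [← this]
    exact plus_of_mem_minus hPN (barMinus_mem hPN g)
  · intro hc
    have := plus_mul_minus hPN g
    rw [hc, one_mul] at this
    rw [← this]
    exact barPlus_of_mem_minus hPN (minus_mem hPN g)

end Factorization

/-- The underlying vector space of the bicrossproduct Hopf algebra `H(G; P, N)` of a unique
factorization `G = P N`: the complex vector space with basis `G`. -/
def BicrossedHopf {G : Type*} [Group G] {P N : Subgroup G} (_ : P.IsComplement' N) : Type _ :=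
  G →₀ ℂ

namespace BicrossedHopf

variable {G : Type*} [Group G] {P N : Subgroup G} (hPN : P.IsComplement' N)

noncomputable instance : AddCommGroup (BicrossedHopf hPN) := inferInstanceAs (AddCommGroup (G →₀ ℂ))

noncomputable instance : Module ℂ (BicrossedHopf hPN) := inferInstanceAs (Module ℂ (G →₀ ℂ))

/-- The basis of `H(G; P, N)` given by the elements of `G`. -/
noncomputable def basis : Module.Basis G ℂ (BicrossedHopf hPN) :=
  Module.Basis.ofRepr (LinearEquiv.refl ℂ (G →₀ ℂ))

/-- The basis element `{g}`. -/
noncomputable def of (g : G) : BicrossedHopf hPN := basis hPN g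

open Classical in
/-- The bilinear multiplication `{g} {h} = δ_{ḡ₊, h₊} {g h₋}`; here `ḡ₊ = (g₊) ^ (g₋)`. -/
noncomputable def mulLin :
    BicrossedHopf hPN →ₗ[ℂ] BicrossedHopf hPN →ₗ[ℂ] BicrossedHopf hPN :=
  (basis hPN).constr ℂ fun g => (basis hPN).constr ℂ fun h =>
    if barPlus hPN g = plus hPN h then of hPN (g * minus hPN h) else 0

open Classical in
lemma mulLin_of (g h : G) : mulLin hPN (of hPN g) (of hPN h) =
    if barPlus hPN g = plus hPN h then of hPN (g * minus hPN h) else 0 := by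
  simp [mulLin, of]

lemma mulLin_assoc (a b c : BicrossedHopf hPN) :
    mulLin hPN (mulLin hPN a b) c = mulLin hPN a (mulLin hPN b c) := by
  have : (mulLin hPN).compr₂ (mulLin hPN) =
      (LinearMap.llcomp ℂ _ _ _ ∘ₗ (mulLin hPN)).compl₂ (mulLin hPN) := by
    refine (basis hPN).ext fun g => (basis hPN).ext fun h => (basis hPN).ext fun k => ?_
    change mulLin hPN (mulLin hPN (of hPN g) (of hPN h)) (of hPN k) =
      mulLin hPN (of hPN g) (mulLin hPN (of hPN h) (of hPN k))
    classical
    rw [mulLin_of, mulLin_of]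
    by_cases h1 : barPlus hPN g = plus hPN h
    · have h2 : barPlus hPN (g * minus hPN h) = barPlus hPN h := by
        rw [← barPlus_barPlus_mul, h1, plus_mul_minus]
      by_cases h3 : barPlus hPN h = plus hPN k
      · simp [h1, h2, h3, mulLin_of, plus_mul_of_mem, minus_mul_of_mem, minus_mem, mul_assoc]
      · simp [h1, h2, h3, mulLin_of]
    · by_cases h3 : barPlus hPN h = plus hPN k
      · simp [h1, h3, mulLin_of, plus_mul_of_mem, minus_mem]
      · simp [h1, h3]
  exact congr($this a b c)

section Fintype

variable [Fintype G]

open Classical in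
noncomputable instance : One (BicrossedHopf hPN) := ⟨∑ u : P, of hPN u⟩

open Classical in
lemma one_def : (1 : BicrossedHopf hPN) = ∑ u : P, of hPN u := rfl

lemma one_mulLin (a : BicrossedHopf hPN) : mulLin hPN 1 a = a := by
  have : mulLin hPN 1 = LinearMap.id := by
    refine (basis hPN).ext fun g => ?_
    change mulLin hPN 1 (of hPN g) = of hPN g
    classical
    rw [one_def, map_sum, LinearMap.sum_apply,
      Finset.sum_eq_single (⟨plus hPN g, plus_mem hPN g⟩ : P)]
    · simp [mulLin_of, barPlus_of_mem hPN (plus_mem hPN g), plus_mul_minus]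
    · intro u _ hu
      rw [mulLin_of, barPlus_of_mem hPN u.2, if_neg]
      exact fun h => hu (Subtype.ext h)
    · simp
  exact congr($this a)

lemma mulLin_one (a : BicrossedHopf hPN) : mulLin hPN a 1 = a := by
  have : (mulLin hPN).flip 1 = LinearMap.id := by
    refine (basis hPN).ext fun g => ?_
    change mulLin hPN (of hPN g) 1 = of hPN g
    classical
    rw [one_def, map_sum, Finset.sum_eq_single (⟨barPlus hPN g, barPlus_mem hPN g⟩ : P)]
    · simp [mulLin_of, plus_of_mem hPN (barPlus_mem hPN g), minus_of_mem hPN (barPlus_mem hPN g)]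
    · intro u _ hu
      rw [mulLin_of, plus_of_mem hPN u.2, if_neg]
      exact fun h => hu (Subtype.ext h.symm)
    · simp
  exact congr($this a)

noncomputable instance : Ring (BicrossedHopf hPN) where
  __ := (inferInstance : AddCommGroup (BicrossedHopf hPN))
  __ := (inferInstance : One (BicrossedHopf hPN))
  mul a b := mulLin hPN a b
  left_distrib a b c := map_add (mulLin hPN a) b c
  right_distrib a b c := LinearMap.map_add₂ (mulLin hPN) a b c
  zero_mul a := LinearMap.map_zero₂ (mulLin hPN) a
  mul_zero a := map_zero (mulLin hPN a)
  mul_assoc := mulLin_assoc hPN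
  one_mul := one_mulLin hPN
  mul_one := mulLin_one hPN

lemma mul_def (a b : BicrossedHopf hPN) : a * b = mulLin hPN a b := rfl

noncomputable instance : Algebra ℂ (BicrossedHopf hPN) :=
  Algebra.ofModule (fun r a b => LinearMap.map_smul₂ (mulLin hPN) r a b)
    (fun r a b => map_smul (mulLin hPN a) r b)

open Classical in
lemma of_mul_of (g h : G) : of hPN g * of hPN h =
    if barPlus hPN g = plus hPN h then of hPN (g * minus hPN h) else 0 :=
  mulLin_of hPN g h

open Classical in
/-- The comultiplication `Δ{g} = ∑_{h ∈ P} {g₊ h⁻¹ (ʰg₋)} ⊗ {h g₋}` and the counit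
`ε{g} = δ_{g₊, e}`; here `ʰg₋` is the component in `N` of `h g₋` for the factorization
`G = N P`. -/
noncomputable instance : CoalgebraStruct ℂ (BicrossedHopf hPN) where
  comul := (basis hPN).constr ℂ fun g => ∑ h : P,
    of hPN (plus hPN g * (h : G)⁻¹ * barMinus hPN (h * minus hPN g)) ⊗ₜ[ℂ]
      of hPN (h * minus hPN g)
  counit := (basis hPN).constr ℂ fun g => if plus hPN g = 1 then 1 else 0

open Classical in
lemma comul_of (g : G) : Coalgebra.comul (R := ℂ) (of hPN g) = ∑ h : P,
    of hPN (g * (barPlus hPN (h * minus hPN g))⁻¹) ⊗ₜ[ℂ] of hPN (h * minus hPN g) := by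
  simp only [← plus_mul_inv_mul_barMinus]
  exact (basis hPN).constr_basis ℂ _ g

open Classical in
lemma counit_of (g : G) : Coalgebra.counit (R := ℂ) (of hPN g) =
    if plus hPN g = 1 then 1 else 0 :=
  (basis hPN).constr_basis ℂ _ g

noncomputable instance : Coalgebra ℂ (BicrossedHopf hPN) where
  coassoc := by
    refine (basis hPN).ext fun g => ?_
    change (TensorProduct.assoc ℂ _ _ _) (Coalgebra.comul.rTensor _
      (Coalgebra.comul (of hPN g))) = Coalgebra.comul.lTensor _ (Coalgebra.comul (of hPN g))
    classical
    simp only [comul_of, map_sum, LinearMap.rTensor_tmul, LinearMap.lTensor_tmul,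
      TensorProduct.sum_tmul, TensorProduct.tmul_sum, TensorProduct.assoc_tmul]
    conv_rhs => rw [Finset.sum_comm]
    refine Finset.sum_congr rfl fun h _ => ?_
    refine Fintype.sum_equiv (Equiv.mulRight h) _ _ fun k => ?_
    have e1 : k * minus hPN (g * (barPlus hPN (h * minus hPN g))⁻¹) =
        k * h * minus hPN g * (barPlus hPN (h * minus hPN g))⁻¹ := by
      rw [minus_mul_barPlus_inv hPN g h h.2]
      group
    have e2 : minus hPN (k * h * minus hPN g) = minus hPN g := by
      rw [minus_of_mem_mul hPN (P.mul_mem k.2 h.2), minus_of_mem_minus hPN (minus_mem hPN g)]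
    simp only [e1, e2, Equiv.coe_mulRight,
      barPlus_mul_of_mem hPN _ (P.inv_mem (barPlus_mem hPN _)), Subgroup.coe_mul]
    congr 2
    group
  rTensor_counit_comp_comul := by
    refine (basis hPN).ext fun g => ?_
    change Coalgebra.counit.rTensor _ (Coalgebra.comul (of hPN g)) = 1 ⊗ₜ[ℂ] of hPN g
    classical
    simp only [comul_of, map_sum, LinearMap.rTensor_tmul, counit_of]
    rw [Finset.sum_eq_single (⟨plus hPN g, plus_mem hPN g⟩ : P)]
    · rw [plus_mul_barPlus_inv hPN _ _ (plus_mem hPN g)]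
      simp [plus_mul_minus]
    · intro u _ hu
      rw [plus_mul_barPlus_inv hPN _ _ u.2, if_neg, TensorProduct.zero_tmul]
      exact fun h => hu (Subtype.ext (mul_inv_eq_one.mp h).symm)
    · simp
  lTensor_counit_comp_comul := by
    refine (basis hPN).ext fun g => ?_
    change Coalgebra.counit.lTensor _ (Coalgebra.comul (of hPN g)) = of hPN g ⊗ₜ[ℂ] 1
    classical
    simp only [comul_of, map_sum, LinearMap.lTensor_tmul, counit_of]
    rw [Finset.sum_eq_single (1 : P)]
    · simp [plus_of_mem_minus hPN (minus_mem hPN g), barPlus_of_mem_minus hPN (minus_mem hPN g)]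
    · intro u _ hu
      rw [plus_mul_of_mem hPN _ (minus_mem hPN g), plus_of_mem hPN u.2, if_neg,
        TensorProduct.tmul_zero]
      exact fun h => hu (Subtype.ext h)
    · simp

noncomputable instance : Bialgebra ℂ (BicrossedHopf hPN) where
  counit_one := by
    classical
    simp only [one_def, map_sum, counit_of]
    rw [Finset.sum_eq_single (1 : P)]
    · simp [plus_one]
    · intro u _ hu
      rw [plus_of_mem hPN u.2, if_neg]
      exact fun h => hu (Subtype.ext h)
    · simp
  mul_compr₂_counit := by
    refine (basis hPN).ext fun g => (basis hPN).ext fun k => ?_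
    change Coalgebra.counit (of hPN g * of hPN k) =
      Coalgebra.counit (R := ℂ) (of hPN g) * Coalgebra.counit (R := ℂ) (of hPN k)
    classical
    rw [of_mul_of, apply_ite Coalgebra.counit, map_zero, counit_of, counit_of, counit_of,
      plus_mul_of_mem hPN _ (minus_mem hPN k)]
    by_cases h1 : plus hPN g = 1
    · simp [h1, (barPlus_eq_one_iff hPN g).2 h1, eq_comm]
    · simp [h1]
  comul_one := by
    classical
    simp only [one_def, map_sum, comul_of, Algebra.TensorProduct.one_def, TensorProduct.sum_tmul,
      TensorProduct.tmul_sum]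
    rw [Finset.sum_comm]
    refine Finset.sum_congr rfl fun h _ => ?_
    refine Fintype.sum_equiv (Equiv.mulRight h⁻¹) _ _ fun u => ?_
    simp [minus_of_mem hPN u.2, barPlus_of_mem hPN h.2]
  mul_compr₂_comul := by
    refine (basis hPN).ext fun g => (basis hPN).ext fun k => ?_
    change Coalgebra.comul (of hPN g * of hPN k) =
      Coalgebra.comul (R := ℂ) (of hPN g) * Coalgebra.comul (R := ℂ) (of hPN k)
    classical
    have hn := minus_mem hPN
    rw [of_mul_of, apply_ite Coalgebra.comul, map_zero, comul_of, comul_of, comul_of,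
      Finset.sum_mul_sum]
    have key (h : P) : (∑ l : P,
        (of hPN (g * (barPlus hPN (h * minus hPN g))⁻¹) ⊗ₜ[ℂ] of hPN (h * minus hPN g)) *
          (of hPN (k * (barPlus hPN (l * minus hPN k))⁻¹) ⊗ₜ[ℂ] of hPN (l * minus hPN k))) =
        if barPlus hPN g = plus hPN k then
          of hPN (g * minus hPN k * (barPlus hPN (h * minus hPN (g * minus hPN k)))⁻¹) ⊗ₜ[ℂ]
            of hPN (h * minus hPN (g * minus hPN k)) else 0 := by
      rw [Finset.sum_eq_single
        (⟨barPlus hPN (h * minus hPN g), barPlus_mem hPN _⟩ : P)]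
      · rw [Algebra.TensorProduct.tmul_mul_tmul, of_mul_of, of_mul_of,
          barPlus_mul_of_mem hPN _ (P.inv_mem (barPlus_mem hPN _)),
          plus_mul_barPlus_inv hPN _ _ (barPlus_mem hPN _), mul_left_inj,
          plus_mul_of_mem hPN _ (hn k), plus_of_mem hPN (barPlus_mem hPN _), if_pos rfl,
          minus_mul_barPlus_inv hPN _ _ (barPlus_mem hPN _), barPlus_barPlus_mul,
          minus_of_mem_mul hPN (barPlus_mem hPN _), minus_of_mem_minus hPN (hn k),
          minus_mul_of_mem hPN _ (hn k), TensorProduct.ite_tmul]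
        refine if_congr Iff.rfl ?_ rfl
        congr 2
        · group
        · group
      · intro l _ hl
        rw [Algebra.TensorProduct.tmul_mul_tmul, of_mul_of hPN (h * minus hPN g),
          plus_mul_of_mem hPN _ (hn k), plus_of_mem hPN l.2, if_neg, TensorProduct.tmul_zero]
        exact fun e => hl (Subtype.ext e.symm)
      · simp
    rw [Finset.sum_congr rfl fun h _ => key h]
    split_ifs
    · rfl
    · simp

/-- The antipode `S{g} = {g⁻¹}`. -/
noncomputable instance : HopfAlgebraStruct ℂ (BicrossedHopf hPN) where
  antipode := (basis hPN).constr ℂ fun g => of hPN g⁻¹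

lemma antipode_of (g : G) : HopfAlgebra.antipode ℂ (of hPN g) = of hPN g⁻¹ :=
  (basis hPN).constr_basis ℂ _ g

noncomputable instance : HopfAlgebra ℂ (BicrossedHopf hPN) where
  mul_antipode_rTensor_comul := by
    refine (basis hPN).ext fun g => ?_
    change LinearMap.mul' ℂ _ ((HopfAlgebra.antipode ℂ).rTensor _ (Coalgebra.comul (of hPN g))) =
      algebraMap ℂ _ (Coalgebra.counit (of hPN g))
    classical
    simp only [comul_of, map_sum, LinearMap.rTensor_tmul, LinearMap.mul'_apply, antipode_of,
      counit_of, of_mul_of]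
    have e1 (h : P) : barPlus hPN (g * (barPlus hPN (h * minus hPN g))⁻¹)⁻¹ =
        h * (plus hPN g)⁻¹ := by
      rw [barPlus, inv_inv, plus_mul_barPlus_inv hPN g h h.2, mul_inv_rev, inv_inv]
    have e2 (h : P) : plus hPN (h * minus hPN g) = h := by
      rw [plus_mul_of_mem hPN _ (minus_mem hPN g), plus_of_mem hPN h.2]
    have e3 (h : P) : minus hPN (h * minus hPN g) = minus hPN g := by
      rw [minus_of_mem_mul hPN h.2, minus_of_mem_minus hPN (minus_mem hPN g)]
    simp only [e1, e2, e3, mul_eq_left, inv_eq_one]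
    by_cases hg : plus hPN g = 1
    · have hg' : minus hPN g = g := by simpa [hg] using plus_mul_minus hPN g
      simp only [hg, if_true, hg', map_one, one_def]
      have hinj : Function.Injective fun h : P =>
          (⟨barPlus hPN (h * g), barPlus_mem hPN _⟩ : P) := by
        intro h h' e
        have e' : barPlus hPN (h * g) = barPlus hPN (h' * g) := congrArg Subtype.val e
        have e'' : barPlus hPN (barPlus hPN (h * g) * g⁻¹) =
            barPlus hPN (barPlus hPN (h' * g) * g⁻¹) := by rw [e']
        rw [barPlus_barPlus_mul, barPlus_barPlus_mul, mul_inv_cancel_right, mul_inv_cancel_right,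
          barPlus_of_mem hPN h.2, barPlus_of_mem hPN h'.2] at e''
        exact Subtype.ext e''
      refine Fintype.sum_bijective _ (Finite.injective_iff_bijective.mp hinj) _ _ fun h => ?_
      congr 1
      group
    · simp [hg]
  mul_antipode_lTensor_comul := by
    refine (basis hPN).ext fun g => ?_
    change LinearMap.mul' ℂ _ ((HopfAlgebra.antipode ℂ).lTensor _ (Coalgebra.comul (of hPN g))) =
      algebraMap ℂ _ (Coalgebra.counit (of hPN g))
    classical
    simp only [comul_of, map_sum, LinearMap.lTensor_tmul, LinearMap.mul'_apply, antipode_of,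
      counit_of, of_mul_of]
    have e1 (h : P) : plus hPN (h * minus hPN g)⁻¹ = (barPlus hPN (h * minus hPN g))⁻¹ := by
      rw [barPlus, inv_inv]
    have e2 (h : P) : minus hPN (h * minus hPN g)⁻¹ =
        barPlus hPN (h * minus hPN g) * (h * minus hPN g)⁻¹ := by
      rw [minus_eq, e1, inv_inv]
    simp only [barPlus_mul_of_mem hPN _ (P.inv_mem (barPlus_mem hPN _)), e1, e2, mul_eq_right,
      barPlus_eq_one_iff]
    by_cases hg : plus hPN g = 1
    · have hg' : minus hPN g = g := by simpa [hg] using plus_mul_minus hPN g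
      simp only [hg, if_true, hg', map_one, one_def]
      refine Fintype.sum_equiv (Equiv.inv P) _ _ fun h => ?_
      simp
    · simp [hg]

end Fintype

end BicrossedHopf

section QuasiTriangular

variable {H : Type*} [Ring H] [HopfAlgebra ℂ H]

/-- `R ∈ H ⊗ H` is a quasi-triangular structure on the Hopf algebra `H`. -/
structure IsQuasiTriangular (R : H ⊗[ℂ] H) : Prop where
  isUnit : IsUnit R
  /-- `τΔ(a) = R Δ(a) R⁻¹`. -/
  comm_comul (a : H) :
    TensorProduct.comm ℂ H H (Coalgebra.comul a) * R = R * Coalgebra.comul a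
  /-- `(Δ ⊗ id) R = R₁₃ R₂₃` in `H ⊗ H ⊗ H`. -/
  comul_rTensor :
    TensorProduct.assoc ℂ H H H (Coalgebra.comul.rTensor H R) =
      (Algebra.TensorProduct.includeRight (R := ℂ) (A := H) (B := H)).toLinearMap.lTensor H R *
        (1 : H) ⊗ₜ[ℂ] R
  /-- `(id ⊗ Δ) R = R₁₃ R₁₂` in `H ⊗ H ⊗ H`. -/
  comul_lTensor :
    Coalgebra.comul.lTensor H R =
      (Algebra.TensorProduct.includeRight (R := ℂ) (A := H) (B := H)).toLinearMap.lTensor H R *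
        TensorProduct.assoc ℂ H H H (R ⊗ₜ[ℂ] (1 : H))
  /-- `(ε ⊗ id) R = 1`. -/
  counit_rTensor : TensorProduct.lid ℂ H (Coalgebra.counit.rTensor H R) = 1
  /-- `(id ⊗ ε) R = 1`. -/
  counit_lTensor : TensorProduct.rid ℂ H (Coalgebra.counit.lTensor H R) = 1

variable {ι : Type*}

/-- A basis of a Hopf algebra over `ℂ` is positive if all the structure constants (of the
multiplication, unit, comultiplication, counit and antipode) are non-negative real numbers.
(`0 ≤ z` for `z : ℂ` means that `z` is real and non-negative.) -/
structure IsPositiveBasis (b : Module.Basis ι ℂ H) : Prop where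
  mul_nonneg (i j k : ι) : 0 ≤ b.repr (b i * b j) k
  one_nonneg (k : ι) : 0 ≤ b.repr 1 k
  comul_nonneg (i j k : ι) : 0 ≤ (b.tensorProduct b).repr (Coalgebra.comul (b i)) (j, k)
  counit_nonneg (i : ι) : 0 ≤ Coalgebra.counit (R := ℂ) (b i)
  antipode_nonneg (i j : ι) : 0 ≤ b.repr (HopfAlgebra.antipode ℂ (b i)) j

/-- `R ∈ H ⊗ H` is positive with respect to a basis `b` of `H` if it has non-negative coefficients
in the basis `b ⊗ b` of `H ⊗ H`. -/
def IsPositive (b : Module.Basis ι ℂ H) (R : H ⊗[ℂ] H) : Prop :=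
  ∀ i j : ι, 0 ≤ (b.tensorProduct b).repr R (i, j)

variable {H' : Type*} [Ring H'] [HopfAlgebra ℂ H']

/-- A quasi-isomorphism `H' → H` of Hopf algebras: an isomorphism of algebras `φ` (compatible with
the counits), together with an invertible twist `T ∈ H ⊗ H` through which `φ` intertwines the
comultiplications, `T` being a counital 2-cocycle. -/
structure IsQuasiIso (φ : H' ≃ₐ[ℂ] H) (T : (H ⊗[ℂ] H)ˣ) : Prop where
  /-- `ε(φ(a)) = ε(a)`. -/
  counit_map (a : H') : Coalgebra.counit (R := ℂ) (φ a) = Coalgebra.counit (R := ℂ) a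
  /-- `(φ ⊗ φ) Δ(a) = T Δ(φ(a)) T⁻¹`. -/
  map_comul (a : H') :
    TensorProduct.map φ.toLinearMap φ.toLinearMap (Coalgebra.comul a) =
      (T : H ⊗[ℂ] H) * Coalgebra.comul (φ a) * (↑T⁻¹ : H ⊗[ℂ] H)
  /-- `(T ⊗ 1) (Δ ⊗ id) T = (1 ⊗ T) (id ⊗ Δ) T` in `H ⊗ H ⊗ H`. -/
  cocycle :
    TensorProduct.assoc ℂ H H H ((T : H ⊗[ℂ] H) ⊗ₜ[ℂ] (1 : H)) *
        TensorProduct.assoc ℂ H H H (Coalgebra.comul.rTensor H (T : H ⊗[ℂ] H)) =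
      (1 : H) ⊗ₜ[ℂ] (T : H ⊗[ℂ] H) * Coalgebra.comul.lTensor H (T : H ⊗[ℂ] H)
  /-- `(ε ⊗ id) T = 1`. -/
  counit_rTensor : TensorProduct.lid ℂ H (Coalgebra.counit.rTensor H (T : H ⊗[ℂ] H)) = 1
  /-- `(id ⊗ ε) T = 1`. -/
  counit_lTensor : TensorProduct.rid ℂ H (Coalgebra.counit.lTensor H (T : H ⊗[ℂ] H)) = 1

/-- The pairs `(H', R')` and `(H, R)` are quasi-isomorphic: there is a quasi-isomorphism
`(φ, T) : H' → H` of Hopf algebras with `(φ ⊗ φ) R' = τ(T) R T⁻¹`. -/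
def QuasiIsomorphic (R' : H' ⊗[ℂ] H') (R : H ⊗[ℂ] H) : Prop :=
  ∃ (φ : H' ≃ₐ[ℂ] H) (T : (H ⊗[ℂ] H)ˣ), IsQuasiIso φ T ∧
    TensorProduct.map φ.toLinearMap φ.toLinearMap R' =
      TensorProduct.comm ℂ H H (T : H ⊗[ℂ] H) * R * (↑T⁻¹ : H ⊗[ℂ] H)

end QuasiTriangular

section Normal

variable {G : Type*} [Group G] {P N : Subgroup G} (hPN : P.IsComplement' N)

/-- The conditions on a pair of homomorphisms `ξ, η : P → N` (for `G = P N`): the sets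
`P' = {u ξ(u⁻¹)}` and `P'' = {η(u⁻¹) u}` are normal subgroups of `G`, and
`F(u ξ(u⁻¹)) = η(u) u⁻¹` defines a group isomorphism `F : P' → P''`. -/
def IsAdmissible (ξ η : P →* N) : Prop :=
  ∃ P' P'' : Subgroup G,
    (P' : Set G) = Set.range (fun u : P => (u : G) * ξ u⁻¹) ∧
    (P'' : Set G) = Set.range (fun u : P => (η u⁻¹ : G) * u) ∧
    P'.Normal ∧ P''.Normal ∧
    ∃ F : P' ≃* P'', ∀ (u : P) (a : P'), (a : G) = u * ξ u⁻¹ → (F a : G) = η u * (u : G)⁻¹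

open Classical in
/-- The element `∑_{u, v ∈ P} {u (η(v)ᵘ)⁻¹} ⊗ {v ξ(u)}` of `H(G; P, N) ⊗ H(G; P, N)`; here `η(v)ᵘ`
is the component in `N` of `η(v) u` for the factorization `G = P N`. -/
noncomputable def rMatrix [Fintype G] (ξ η : P →* N) :
    BicrossedHopf hPN ⊗[ℂ] BicrossedHopf hPN :=
  ∑ u : P, ∑ v : P,
    BicrossedHopf.of hPN ((u : G) * (minus hPN (η v * u))⁻¹) ⊗ₜ[ℂ]
      BicrossedHopf.of hPN ((v : G) * ξ u)

/-- `R` is a normal positive quasi-triangular structure on `H(G; P, N)`: it is given by a pair of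
homomorphisms `ξ, η : P → N` with `ξ` trivial. -/
def IsNormal [Fintype G] (R : BicrossedHopf hPN ⊗[ℂ] BicrossedHopf hPN) : Prop :=
  IsQuasiTriangular R ∧ IsPositive (BicrossedHopf.basis hPN) R ∧
    ∃ ξ η : P →* N, IsAdmissible ξ η ∧ R = rMatrix hPN ξ η ∧ ∀ u : P, ξ u = 1

end Normal

end PositiveHopf

/-!
Non-negative structure constants cannot cancel, so their supports form a Hopf monoid in the
category of sets and relations. Such an object is a groupoid for its product and for its coproduct,
hence the set of arrows of a matched pair of groups. The logarithms of the structure constants are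
then cocycles on finite groups, which are trivialized by averaging: after rescaling by positive
numbers the basis is that of a bicrossproduct.

A positive invertible `R` consists of one arrow for each pair of objects, and its coefficients form
a positive bicharacter up to permutations, so they are all `1`, and
`R = ∑ e(u, A(u, v)) ⊗ e(v, ξ(u))`. The axioms of `R` turn into two retractions of the product
group onto `J` with commuting kernels. Factorizing the product group by the kernel of the first
retraction instead of `I` makes the positive factor normal. The twist
`T = ∑ e(u, ξ(v)⁻¹) ⊗ e(v, 1)` implements this change of factorization, and it carries `R` to the
normal structure defined by the second retraction.
-/

namespace PositiveHopf

/-- A Hopf monoid in the category of sets and relations: `Mul i j k` says that `k` occurs in the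
product of `i` and `j`, `Comul i j k` that `i ⊗ j` occurs in the coproduct of `k`, and `Unit`,
`Counit` and `Antipode` are the supports of the unit, the counit and the antipode. The structure
constants of a Hopf algebra in a positive basis enter the classification through such relations. -/
structure RelHopf (ι : Type*) where
  Mul : ι → ι → ι → Prop
  Comul : ι → ι → ι → Prop
  Unit : ι → Prop
  Counit : ι → Prop
  Antipode : ι → ι → Prop
  assoc (i j k l : ι) : (∃ p, Mul i j p ∧ Mul p k l) ↔ ∃ q, Mul j k q ∧ Mul i q l
  coassoc (i j k l : ι) : (∃ p, Comul i j p ∧ Comul p k l) ↔ ∃ q, Comul j k q ∧ Comul i q l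
  unit_mul (i j : ι) : (∃ e, Unit e ∧ Mul e i j) ↔ i = j
  mul_unit (i j : ι) : (∃ e, Unit e ∧ Mul i e j) ↔ i = j
  counit_comul (i j : ι) : (∃ c, Counit c ∧ Comul c i j) ↔ i = j
  comul_counit (i j : ι) : (∃ c, Counit c ∧ Comul i c j) ↔ i = j
  mul_comul (i j k l : ι) : (∃ p, Mul i j p ∧ Comul k l p) ↔
    ∃ a b c d, Comul a b i ∧ Comul c d j ∧ Mul a c k ∧ Mul b d l
  comul_unit (i j : ι) : (∃ e, Unit e ∧ Comul i j e) ↔ Unit i ∧ Unit j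
  counit_mul (i j : ι) : (∃ c, Counit c ∧ Mul i j c) ↔ Counit i ∧ Counit j
  counit_unit : ∃ e, Unit e ∧ Counit e
  antipode_left (k l : ι) :
    (∃ i j i', Comul i j k ∧ Antipode i i' ∧ Mul i' j l) ↔ Counit k ∧ Unit l
  antipode_right (k l : ι) :
    (∃ i j j', Comul i j k ∧ Antipode j j' ∧ Mul i j' l) ↔ Counit k ∧ Unit l

namespace RelHopf

variable {ι : Type*} (h : RelHopf ι)

/-- The dual Hopf monoid in relations, which makes every statement about multiplication available
for comultiplication. -/
def dual : RelHopf ι where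
  Mul := h.Comul
  Comul := h.Mul
  Unit := h.Counit
  Counit := h.Unit
  Antipode i j := h.Antipode j i
  assoc := h.coassoc
  coassoc := h.assoc
  unit_mul := h.counit_comul
  mul_unit := h.comul_counit
  counit_comul := h.unit_mul
  comul_counit := h.mul_unit
  mul_comul i j k l := by
    have := h.mul_comul k l i j
    constructor
    · rintro ⟨p, h1, h2⟩
      obtain ⟨a, b, c, d, h3, h4, h5, h6⟩ := this.1 ⟨p, h2, h1⟩
      exact ⟨a, c, b, d, h5, h6, h3, h4⟩
    · rintro ⟨a, b, c, d, h3, h4, h5, h6⟩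
      obtain ⟨p, h1, h2⟩ := this.2 ⟨a, c, b, d, h5, h6, h3, h4⟩
      exact ⟨p, h2, h1⟩
  comul_unit := h.counit_mul
  counit_mul := h.comul_unit
  counit_unit := h.counit_unit.imp fun _ => And.symm
  antipode_left k l := by
    rw [and_comm, ← h.antipode_left l k]
    constructor <;> exact fun ⟨i, j, i', h1, h2, h3⟩ => ⟨i', j, i, h3, h2, h1⟩
  antipode_right k l := by
    rw [and_comm, ← h.antipode_right l k]
    constructor <;> exact fun ⟨i, j, j', h1, h2, h3⟩ => ⟨i, j', j, h3, h2, h1⟩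

/-- The constituents of the unit; they are the objects of the groupoid formed by the elements of
`ι` under multiplication. -/
def Obj : Type _ := {i // h.Unit i}

instance : CoeOut h.Obj ι := ⟨Subtype.val⟩

noncomputable instance [Finite ι] : Fintype h.Obj :=
  have : Finite h.Obj := Subtype.finite
  Fintype.ofFinite _

/-- The constituent of the unit acting trivially on `b` from the left. -/
noncomputable def src (b : ι) : h.Obj :=
  ⟨((h.unit_mul b b).2 rfl).choose, ((h.unit_mul b b).2 rfl).choose_spec.1⟩

/-- The constituent of the unit acting trivially on `b` from the right. -/
noncomputable def tgt (b : ι) : h.Obj :=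
  ⟨((h.mul_unit b b).2 rfl).choose, ((h.mul_unit b b).2 rfl).choose_spec.1⟩

lemma src_mul_self (b : ι) : h.Mul (h.src b) b b := ((h.unit_mul b b).2 rfl).choose_spec.2

lemma self_mul_tgt (b : ι) : h.Mul b (h.tgt b) b := ((h.mul_unit b b).2 rfl).choose_spec.2

variable {h}

lemma Obj.ext {i j : h.Obj} (hij : (i : ι) = j) : i = j := Subtype.ext hij

lemma eq_of_unit_mul {e i j : ι} (he : h.Unit e) (hm : h.Mul e i j) : i = j :=
  (h.unit_mul i j).1 ⟨e, he, hm⟩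

lemma eq_of_mul_unit {e i j : ι} (he : h.Unit e) (hm : h.Mul i e j) : i = j :=
  (h.mul_unit i j).1 ⟨e, he, hm⟩

lemma src_eq_of_unit_mul {e i j : ι} (he : h.Unit e) (hm : h.Mul e i j) : (h.src i : ι) = e := by
  obtain rfl := eq_of_unit_mul he hm
  obtain ⟨p, hp, -⟩ := (h.assoc _ _ _ _).2 ⟨i, h.src_mul_self i, hm⟩
  exact (eq_of_unit_mul he hp).trans (eq_of_mul_unit (h.src i).2 hp).symm

lemma tgt_eq_of_mul_unit {e i j : ι} (he : h.Unit e) (hm : h.Mul i e j) : (h.tgt i : ι) = e := by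
  obtain rfl := eq_of_mul_unit he hm
  obtain ⟨p, hp, -⟩ := (h.assoc _ _ _ _).1 ⟨i, h.self_mul_tgt i, hm⟩
  exact (eq_of_mul_unit he hp).trans (eq_of_unit_mul (h.tgt i).2 hp).symm

lemma src_mul {a b c : ι} (hm : h.Mul a b c) : h.src c = h.src a := by
  obtain ⟨q, -, hq⟩ := (h.assoc _ _ _ _).1 ⟨a, h.src_mul_self a, hm⟩
  obtain rfl := eq_of_unit_mul (h.src a).2 hq
  exact Obj.ext (src_eq_of_unit_mul (h.src a).2 hq)

lemma tgt_mul {a b c : ι} (hm : h.Mul a b c) : h.tgt c = h.tgt b := by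
  obtain ⟨q, -, hq⟩ := (h.assoc _ _ _ _).2 ⟨b, h.self_mul_tgt b, hm⟩
  obtain rfl := eq_of_mul_unit (h.tgt b).2 hq
  exact Obj.ext (tgt_eq_of_mul_unit (h.tgt b).2 hq)

lemma tgt_eq_src_of_mul {a b c : ι} (hm : h.Mul a b c) : h.tgt a = h.src b := by
  obtain ⟨q, hq, -⟩ := (h.assoc _ _ _ _).1 ⟨a, h.self_mul_tgt a, hm⟩
  exact (Obj.ext (src_eq_of_unit_mul (h.tgt a).2 hq)).symm

lemma src_coe (i : h.Obj) : h.src i = i := Obj.ext (eq_of_mul_unit i.2 (h.src_mul_self i) :)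

lemma tgt_coe (i : h.Obj) : h.tgt i = i := Obj.ext (eq_of_unit_mul i.2 (h.self_mul_tgt i) :)

lemma src_eq_of_mul_coe {a b : ι} {i : h.Obj} (hm : h.Mul a b i) : h.src a = i := by
  rw [← src_mul hm, src_coe]

lemma coe_mul_coe_self (i : h.Obj) : h.Mul i i i := by
  simpa only [src_coe] using h.src_mul_self i

lemma eq_of_unit_of_counit {c d : ι} (hc : h.Unit c) (hc' : h.Counit c) (hd : h.Unit d)
    (hd' : h.Counit d) : c = d := by
  obtain ⟨k, -, hk⟩ := (h.counit_mul _ _).2 ⟨hc', hd'⟩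
  exact (eq_of_mul_unit hd hk).trans (eq_of_unit_mul hc hk).symm

lemma eq_of_comul_of_unit {i j k k' : ι} (hi : h.Unit i) (hj : h.Unit j) (hk : h.Unit k)
    (hk' : h.Unit k') (hd : h.Comul i j k) (hd' : h.Comul i j k') : k = k' := by
  obtain ⟨p, hp, -⟩ := (h.mul_comul k k' i j).2
    ⟨i, j, i, j, hd, hd', coe_mul_coe_self ⟨i, hi⟩, coe_mul_coe_self ⟨j, hj⟩⟩
  exact (eq_of_mul_unit hk' hp).trans (eq_of_unit_mul hk hp).symm

noncomputable instance : _root_.Mul h.Obj := ⟨fun i j =>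
  ⟨((h.comul_unit i j).2 ⟨i.2, j.2⟩).choose, ((h.comul_unit i j).2 ⟨i.2, j.2⟩).choose_spec.1⟩⟩

noncomputable instance : One h.Obj := ⟨⟨h.counit_unit.choose, h.counit_unit.choose_spec.1⟩⟩

lemma comul_coe_mul (i j : h.Obj) : h.Comul i j (i * j : h.Obj) :=
  ((h.comul_unit i j).2 ⟨i.2, j.2⟩).choose_spec.2

lemma eq_mul_of_comul {i j k : h.Obj} (hd : h.Comul i j k) : k = i * j :=
  Obj.ext (eq_of_comul_of_unit i.2 j.2 k.2 (i * j).2 hd (comul_coe_mul i j))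

lemma counit_one : h.Counit (1 : h.Obj) := h.counit_unit.choose_spec.2

lemma eq_one_of_counit {i : h.Obj} (hi : h.Counit i) : i = 1 :=
  Obj.ext (eq_of_unit_of_counit i.2 hi (1 : h.Obj).2 counit_one)

lemma Obj.mul_assoc (i j k : h.Obj) : i * j * k = i * (j * k) := by
  obtain ⟨q, hjk, hi⟩ := (h.coassoc _ _ _ _).1 ⟨_, comul_coe_mul i j, comul_coe_mul (i * j) k⟩
  obtain ⟨q, rfl⟩ : ∃ q' : h.Obj, (q' : ι) = q :=
    ⟨⟨q, ((h.comul_unit i q).1 ⟨_, (i * j * k).2, hi⟩).2⟩, rfl⟩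
  rw [← eq_mul_of_comul hjk]
  exact eq_mul_of_comul hi

lemma Obj.one_mul (i : h.Obj) : 1 * i = i := by
  obtain ⟨c, hc, hd⟩ := (h.counit_comul (i : ι) i).2 rfl
  obtain ⟨c, rfl⟩ : ∃ c' : h.Obj, (c' : ι) = c :=
    ⟨⟨c, ((h.comul_unit c i).1 ⟨_, i.2, hd⟩).1⟩, rfl⟩
  rw [← eq_one_of_counit hc]
  exact (eq_mul_of_comul hd).symm

lemma Obj.exists_mul_eq_one (l : h.Obj) : ∃ i : h.Obj, i * l = 1 := by
  obtain ⟨i, j, i', hd, -, hm⟩ := (h.antipode_left (1 : h.Obj) l).2 ⟨counit_one, l.2⟩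
  obtain ⟨hi, hj⟩ := (h.comul_unit i j).1 ⟨_, (1 : h.Obj).2, hd⟩
  obtain rfl := eq_of_mul_unit hj hm
  obtain rfl := eq_of_unit_mul l.2 hm
  exact ⟨⟨i, hi⟩, (eq_mul_of_comul (i := ⟨i, hi⟩) hd).symm⟩

noncomputable instance : Inv h.Obj := ⟨fun l => (Obj.exists_mul_eq_one l).choose⟩

noncomputable instance : Group h.Obj :=
  Group.ofLeftAxioms Obj.mul_assoc Obj.one_mul fun l => (Obj.exists_mul_eq_one l).choose_spec

lemma src_eq_one_of_counit {b : ι} (hb : h.Counit b) : h.src b = 1 :=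
  eq_one_of_counit ((h.counit_mul _ _).1 ⟨b, hb, h.src_mul_self b⟩).1

lemma tgt_eq_one_of_counit {b : ι} (hb : h.Counit b) : h.tgt b = 1 :=
  eq_one_of_counit ((h.counit_mul _ _).1 ⟨b, hb, h.self_mul_tgt b⟩).2

lemma src_comul {a b c : ι} (hd : h.Comul a b c) : h.src c = h.src a * h.src b := by
  obtain ⟨p, q, a', b', hpq, -, ha, hb⟩ := (h.mul_comul _ _ _ _).1 ⟨c, h.src_mul_self c, hd⟩
  obtain ⟨hp, hq⟩ := (h.comul_unit _ _).1 ⟨_, (h.src c).2, hpq⟩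
  obtain rfl := eq_of_unit_mul hp ha
  obtain rfl := eq_of_unit_mul hq hb
  rw [← src_eq_of_unit_mul hp ha, ← src_eq_of_unit_mul hq hb] at hpq
  exact eq_mul_of_comul hpq

lemma tgt_comul {a b c : ι} (hd : h.Comul a b c) : h.tgt c = h.tgt a * h.tgt b := by
  obtain ⟨a', b', p, q, -, hpq, ha, hb⟩ := (h.mul_comul _ _ _ _).1 ⟨c, h.self_mul_tgt c, hd⟩
  obtain ⟨hp, hq⟩ := (h.comul_unit _ _).1 ⟨_, (h.tgt c).2, hpq⟩
  obtain rfl := eq_of_mul_unit hp ha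
  obtain rfl := eq_of_mul_unit hq hb
  rw [← tgt_eq_of_mul_unit hp ha, ← tgt_eq_of_mul_unit hq hb] at hpq
  exact eq_mul_of_comul hpq

lemma exists_antipode_mul_eq_one {x : ι} (hx : h.Counit x) :
    ∃ y, h.Antipode x y ∧ h.Mul y x (1 : h.Obj) := by
  obtain ⟨i, j, y, hd, hs, hm⟩ := (h.antipode_left x (1 : h.Obj)).2 ⟨hx, (1 : h.Obj).2⟩
  obtain ⟨-, hj⟩ := (h.counit_mul _ _).1 ⟨_, counit_one, hm⟩
  obtain rfl : i = x := eq_of_mul_unit (h := h.dual) hj hd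
  obtain rfl : j = i := eq_of_unit_mul (h := h.dual) hx hd
  exact ⟨y, hs, hm⟩

lemma exists_mul_antipode_eq_one {x : ι} (hx : h.Counit x) :
    ∃ y, h.Antipode x y ∧ h.Mul x y (1 : h.Obj) := by
  obtain ⟨i, j, y, hd, hs, hm⟩ := (h.antipode_right x (1 : h.Obj)).2 ⟨hx, (1 : h.Obj).2⟩
  obtain ⟨hi, -⟩ := (h.counit_mul _ _).1 ⟨_, counit_one, hm⟩
  obtain rfl : j = x := eq_of_unit_mul (h := h.dual) hi hd
  obtain rfl : i = j := eq_of_mul_unit (h := h.dual) hx hd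
  exact ⟨y, hs, hm⟩

lemma counit_of_tgt_eq_one {b : ι} (hb : h.tgt b = 1) : h.Counit b := by
  obtain ⟨y, hs, hy⟩ := exists_antipode_mul_eq_one (h.dual.tgt b).2
  have hb1 : h.Mul b (1 : h.Obj) b := hb ▸ h.self_mul_tgt b
  obtain ⟨p, hp, -⟩ := (h.assoc _ _ _ _).2 ⟨_, hy, hb1⟩
  exact ((h.antipode_right b p).1 ⟨_, _, _, h.dual.self_mul_tgt b, hs, hp⟩).1

lemma counit_of_src_eq_one {b : ι} (hb : h.src b = 1) : h.Counit b := by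
  obtain ⟨y, hs, hy⟩ := exists_mul_antipode_eq_one (h.dual.src b).2
  have hb1 : h.Mul (1 : h.Obj) b b := hb ▸ h.src_mul_self b
  obtain ⟨p, hp, -⟩ := (h.assoc _ _ _ _).1 ⟨_, hy, hb1⟩
  exact ((h.antipode_left b p).1 ⟨_, _, _, h.dual.src_mul_self b, hs, hp⟩).1

lemma unit_of_dual_tgt_eq_one {b : ι} (hb : h.dual.tgt b = 1) : h.Unit b :=
  counit_of_tgt_eq_one (h := h.dual) hb

lemma unit_of_dual_src_eq_one {b : ι} (hb : h.dual.src b = 1) : h.Unit b :=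
  counit_of_src_eq_one (h := h.dual) hb

lemma dual_src_mul {a b c : ι} (hm : h.Mul a b c) :
    h.dual.src c = h.dual.src a * h.dual.src b :=
  src_comul (h := h.dual) hm

lemma dual_tgt_mul {a b c : ι} (hm : h.Mul a b c) :
    h.dual.tgt c = h.dual.tgt a * h.dual.tgt b :=
  tgt_comul (h := h.dual) hm

lemma dual_src_coe (i : h.Obj) : h.dual.src i = 1 := src_eq_one_of_counit (h := h.dual) i.2

lemma dual_tgt_coe (i : h.Obj) : h.dual.tgt i = 1 := tgt_eq_one_of_counit (h := h.dual) i.2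

lemma dual_src_eq_inv_of_mul_coe {b b' : ι} {i : h.Obj} (hm : h.Mul b b' i) :
    h.dual.src b' = (h.dual.src b)⁻¹ :=
  eq_inv_of_mul_eq_one_right (by rw [← dual_src_mul hm, dual_src_coe])

lemma dual_tgt_eq_inv_of_mul_coe {b b' : ι} {i : h.Obj} (hm : h.Mul b b' i) :
    h.dual.tgt b' = (h.dual.tgt b)⁻¹ :=
  eq_inv_of_mul_eq_one_right (by rw [← dual_tgt_mul hm, dual_tgt_coe])

lemma exists_mul_of_mul_coe {b b' c : ι} {i : h.Obj} (hm : h.Mul b b' i)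
    (hc : h.src c = h.src b) : ∃ r, h.Mul b' c r ∧ h.Mul b r c := by
  refine (h.assoc _ _ _ _).1 ⟨_, hm, ?_⟩
  rw [← src_eq_of_mul_coe hm, ← hc]
  exact h.src_mul_self c

lemma mul_eq_tgt_of_mul_coe {b b' : ι} {i : h.Obj} (hm : h.Mul b b' i) :
    h.Mul b' b (h.tgt b) := by
  obtain ⟨r, hr, hbr⟩ := exists_mul_of_mul_coe hm rfl
  have hr1 : h.Unit r := unit_of_dual_src_eq_one <| by
    rw [dual_src_mul hr, dual_src_eq_inv_of_mul_coe hm, inv_mul_cancel]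
  rwa [tgt_eq_of_mul_unit hr1 hbr]

lemma eq_of_src_eq_of_dual_src_eq {b b' c : ι} {i : h.Obj} (hm : h.Mul b b' i)
    (hs : h.src c = h.src b) (hd : h.dual.src c = h.dual.src b) : c = b := by
  obtain ⟨r, hr, hbr⟩ := exists_mul_of_mul_coe hm hs
  refine (eq_of_mul_unit (unit_of_dual_src_eq_one ?_) hbr).symm
  rw [dual_src_mul hr, dual_src_eq_inv_of_mul_coe hm, hd, inv_mul_cancel]

lemma exists_mul_eq_src (b : ι) : ∃ b', h.Mul b b' (h.src b) := by
  obtain ⟨j, k, j', hd, -, hm⟩ := (h.antipode_right (h.dual.src b) (h.src b)).2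
    ⟨(h.dual.src b).2, (h.src b).2⟩
  have hj : b = j := eq_of_src_eq_of_dual_src_eq hm (src_eq_of_mul_coe hm).symm
    (src_eq_of_mul_coe (h := h.dual) hd).symm
  exact ⟨j', hj ▸ hm⟩

lemma eq_of_src_eq_of_dual_tgt_eq {b c : ι} (hs : h.src b = h.src c)
    (ht : h.dual.tgt b = h.dual.tgt c) : b = c := by
  obtain ⟨c', hm⟩ := exists_mul_eq_src (h := h) c
  obtain ⟨r, hr, hcr⟩ := exists_mul_of_mul_coe hm hs
  refine (eq_of_mul_unit (unit_of_dual_tgt_eq_one ?_) hcr).symm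
  rw [dual_tgt_mul hr, dual_tgt_eq_inv_of_mul_coe hm, ht, inv_mul_cancel]

lemma exists_src_eq_dual_tgt_eq (i : h.Obj) (x : h.dual.Obj) :
    ∃ b, h.src b = i ∧ h.dual.tgt b = x := by
  obtain ⟨j, k, j', hd, -, hm⟩ := (h.antipode_left (x⁻¹ : h.dual.Obj) i).2 ⟨(x⁻¹).2, i.2⟩
  refine ⟨j', src_eq_of_mul_coe hm, ?_⟩
  have hk : h.dual.tgt k = x⁻¹ := by rw [← tgt_mul (h := h.dual) hd, tgt_coe]
  rw [← inv_inv (h.dual.tgt j'), ← dual_tgt_eq_inv_of_mul_coe hm, hk, inv_inv]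

lemma exists_mul_of_tgt_eq_src {a b : ι} (hab : h.tgt a = h.src b) : ∃ c, h.Mul a b c := by
  obtain ⟨a', ha⟩ := exists_mul_eq_src (h := h) a
  have ha' := mul_eq_tgt_of_mul_coe ha
  obtain ⟨r, hr, -⟩ := exists_mul_of_mul_coe ha'
    (hab.symm.trans (src_eq_of_mul_coe ha').symm)
  exact ⟨r, hr⟩

lemma mul_iff {a b c : ι} : h.Mul a b c ↔
    h.tgt a = h.src b ∧ h.src c = h.src a ∧ h.dual.tgt c = h.dual.tgt a * h.dual.tgt b := by
  refine ⟨fun hm => ⟨tgt_eq_src_of_mul hm, src_mul hm, dual_tgt_mul hm⟩, fun ⟨hab, hs, ht⟩ => ?_⟩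
  obtain ⟨d, hd⟩ := exists_mul_of_tgt_eq_src hab
  rwa [eq_of_src_eq_of_dual_tgt_eq (hs.trans (src_mul hd).symm) (ht.trans (dual_tgt_mul hd).symm)]

lemma comul_iff {a b c : ι} : h.Comul a b c ↔
    h.dual.tgt a = h.dual.src b ∧ h.src c = h.src a * h.src b ∧
      h.dual.tgt c = h.dual.tgt b := by
  refine ⟨fun hm => ⟨tgt_eq_src_of_mul (h := h.dual) hm, src_comul hm, tgt_mul (h := h.dual) hm⟩,
    fun ⟨hab, hs, ht⟩ => ?_⟩
  obtain ⟨d, hd⟩ := exists_mul_of_tgt_eq_src (h := h.dual) hab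
  rwa [eq_of_src_eq_of_dual_tgt_eq (hs.trans (src_comul hd).symm)
    (ht.trans (tgt_mul (h := h.dual) hd).symm)]

variable (h) in
/-- The parametrization of the elements by sources and dual targets: `arrow (i, x)` is the element
`b` with `h.src b = i` and `h.dual.tgt b = x`. -/
noncomputable def arrow : h.Obj × h.dual.Obj ≃ ι :=
  (Equiv.ofBijective (fun b => (h.src b, h.dual.tgt b))
    ⟨fun _ _ hbc => eq_of_src_eq_of_dual_tgt_eq (congrArg Prod.fst hbc) (congrArg Prod.snd hbc),
      fun ⟨i, x⟩ => (exists_src_eq_dual_tgt_eq i x).imp fun _ hb => Prod.ext hb.1 hb.2⟩).symm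

lemma src_arrow (i : h.Obj) (x : h.dual.Obj) : h.src (h.arrow (i, x)) = i :=
  congrArg Prod.fst (h.arrow.symm_apply_apply (i, x))

lemma dual_tgt_arrow (i : h.Obj) (x : h.dual.Obj) : h.dual.tgt (h.arrow (i, x)) = x :=
  congrArg Prod.snd (h.arrow.symm_apply_apply (i, x))

lemma eq_arrow {b : ι} {i : h.Obj} {x : h.dual.Obj} (hs : h.src b = i) (ht : h.dual.tgt b = x) :
    b = h.arrow (i, x) :=
  h.arrow.symm_apply_eq.1 (Prod.ext hs ht)

lemma arrow_one (i : h.Obj) : h.arrow (i, 1) = i := (eq_arrow (src_coe i) (dual_tgt_coe i)).symm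

lemma one_arrow (x : h.dual.Obj) : h.arrow (1, x) = x :=
  (eq_arrow (src_eq_one_of_counit x.2) (tgt_coe (h := h.dual) x)).symm

lemma mul_arrow (i : h.Obj) (x y : h.dual.Obj) :
    h.Mul (h.arrow (i, x)) (h.arrow (h.tgt (h.arrow (i, x)), y)) (h.arrow (i, x * y)) := by
  simp [mul_iff, src_arrow, dual_tgt_arrow]

lemma comul_arrow (i j : h.Obj) (x : h.dual.Obj) :
    h.Comul (h.arrow (i, h.dual.src (h.arrow (j, x)))) (h.arrow (j, x))
      (h.arrow (i * j, x)) := by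
  simp [comul_iff, src_arrow, dual_tgt_arrow]

end RelHopf

/-- A matched pair of groups: a right action `i ◁ x = ract i x` of `J` on the set `I` and a left
action `i ▷ x = lact i x` of `I` on the set `J` for which `i x = (i ▷ x) (i ◁ x)` defines a group
structure on `J × I`. -/
structure MatchedPair (I J : Type*) [Group I] [Group J] where
  ract : I → J → I
  lact : I → J → J
  ract_one (i : I) : ract i 1 = i
  ract_mul (i : I) (x y : J) : ract i (x * y) = ract (ract i x) y
  mul_ract (i j : I) (x : J) : ract (i * j) x = ract i (lact j x) * ract j x
  one_lact (x : J) : lact 1 x = x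
  mul_lact (i j : I) (x : J) : lact (i * j) x = lact i (lact j x)
  lact_mul (i : I) (x y : J) : lact i (x * y) = lact i x * lact (ract i x) y

/-- The matched pair of groups of a Hopf monoid in relations. -/
noncomputable def RelHopf.matchedPair {ι : Type*} (h : RelHopf ι) :
    MatchedPair h.Obj h.dual.Obj where
  ract i x := h.tgt (h.arrow (i, x))
  lact i x := h.dual.src (h.arrow (i, x))
  ract_one i := by rw [arrow_one, tgt_coe]
  ract_mul i x y := tgt_mul (mul_arrow i x y)
  mul_ract i j x := tgt_comul (comul_arrow i j x)
  one_lact x := by rw [one_arrow]; exact src_coe (h := h.dual) x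
  mul_lact i j x := src_mul (h := h.dual) (comul_arrow i j x)
  lact_mul i x y := dual_src_mul (mul_arrow i x y)

lemma RelHopf.mul_arrow_iff {ι : Type*} {h : RelHopf ι} {u v t : h.Obj} {x y z : h.dual.Obj} :
    h.Mul (h.arrow (u, x)) (h.arrow (v, y)) (h.arrow (t, z)) ↔
      h.matchedPair.ract u x = v ∧ t = u ∧ z = x * y := by
  simp only [mul_iff, src_arrow, dual_tgt_arrow, matchedPair]

lemma RelHopf.comul_arrow_iff {ι : Type*} {h : RelHopf ι} {c d t : h.Obj} {y z x : h.dual.Obj} :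
    h.Comul (h.arrow (c, y)) (h.arrow (d, z)) (h.arrow (t, x)) ↔
      y = h.matchedPair.lact d z ∧ t = c * d ∧ x = z := by
  simp only [comul_iff, src_arrow, dual_tgt_arrow, matchedPair]

namespace MatchedPair

variable {I J : Type*} [Group I] [Group J] (mp : MatchedPair I J)

lemma one_ract (x : J) : mp.ract 1 x = 1 := by
  simpa [mp.one_lact] using mp.mul_ract 1 1 x

lemma lact_one (i : I) : mp.lact i 1 = 1 := by
  simpa [mp.ract_one] using mp.lact_mul i 1 1

/-- The action of `x : J` as a permutation of `I`. -/
def ractEquiv (x : J) : I ≃ I where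
  toFun i := mp.ract i x
  invFun i := mp.ract i x⁻¹
  left_inv i := by dsimp only; rw [← mp.ract_mul, mul_inv_cancel, mp.ract_one]
  right_inv i := by dsimp only; rw [← mp.ract_mul, inv_mul_cancel, mp.ract_one]

lemma ract_inv_ract (i : I) (x : J) : mp.ract (mp.ract i x⁻¹) x = i :=
  (mp.ractEquiv x).apply_symm_apply i

end MatchedPair

section StructureConstants

open Coalgebra HopfAlgebra

variable {K H ι : Type*} [CommRing K] [Ring H] [HopfAlgebra K H] (b : Module.Basis ι K H)

/-- The structure constants of the multiplication: the coefficient of `b k` in `b i * b j`. -/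
noncomputable def mulCoeff (i j k : ι) : K := b.repr (b i * b j) k

/-- The structure constants of the comultiplication: the coefficient of `b i ⊗ b j` in the
coproduct of `b k`. -/
noncomputable def comulCoeff (i j k : ι) : K := (b.tensorProduct b).repr (comul (b k)) (i, j)

/-- The structure constants of the antipode: the coefficient of `b j` in the antipode of `b i`. -/
noncomputable def antipodeCoeff (i j : ι) : K := b.repr (antipode K (b i)) j

lemma repr_assoc_tmul (t : H ⊗[K] H) (x : H) (i j k : ι) :
    (b.tensorProduct (b.tensorProduct b)).repr (TensorProduct.assoc K H H H (t ⊗ₜ x)) (i, j, k) =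
      (b.tensorProduct b).repr t (i, j) * b.repr x k := by
  induction t with
  | zero => simp
  | tmul y z =>
    simp only [TensorProduct.assoc_tmul, Module.Basis.tensorProduct_repr_tmul_apply, smul_eq_mul]
    ring
  | add s t hs ht =>
    simp only [TensorProduct.add_tmul, map_add, Finsupp.add_apply, hs, ht, add_mul]

lemma mulCoeff_reindex {κ : Type*} (f : ι ≃ κ) (i j k : κ) :
    mulCoeff (b.reindex f) i j k = mulCoeff b (f.symm i) (f.symm j) (f.symm k) := by
  simp [mulCoeff]

lemma comulCoeff_reindex {κ : Type*} (f : ι ≃ κ) (i j k : κ) :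
    comulCoeff (b.reindex f) i j k = comulCoeff b (f.symm i) (f.symm j) (f.symm k) := by
  have hreindex : (b.reindex f).tensorProduct (b.reindex f) =
      (b.tensorProduct b).reindex (f.prodCongr f) :=
    Module.Basis.eq_of_apply_eq fun p => by simp [Module.Basis.tensorProduct_apply']
  rw [comulCoeff, hreindex, Module.Basis.repr_reindex_apply, b.reindex_apply]
  rfl

variable [Fintype ι]

lemma mul_eq_sum_mulCoeff (i j : ι) : b i * b j = ∑ k, mulCoeff b i j k • b k :=
  (b.sum_repr _).symm

lemma comul_eq_sum_comulCoeff (k : ι) :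
    comul (R := K) (b k) = ∑ p : ι × ι, comulCoeff b p.1 p.2 k • b p.1 ⊗ₜ[K] b p.2 := by
  simp only [← Module.Basis.tensorProduct_apply']
  exact ((b.tensorProduct b).sum_repr _).symm

lemma antipode_eq_sum_antipodeCoeff (i : ι) :
    antipode K (b i) = ∑ j, antipodeCoeff b i j • b j :=
  (b.sum_repr _).symm

lemma sum_mulCoeff_mul_mulCoeff (i j k l : ι) :
    ∑ p, mulCoeff b i j p * mulCoeff b p k l = ∑ q, mulCoeff b j k q * mulCoeff b i q l := by
  have h := congrArg (b.repr · l) (mul_assoc (b i) (b j) (b k))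
  simp only [mul_eq_sum_mulCoeff b i j, mul_eq_sum_mulCoeff b j k, Finset.sum_mul,
    Finset.mul_sum, smul_mul_assoc, mul_smul_comm, map_sum, map_smul, Finsupp.finsetSum_apply,
    Finsupp.smul_apply, smul_eq_mul] at h
  exact h

lemma sum_comulCoeff_mul_comulCoeff (i j k l : ι) :
    ∑ p, comulCoeff b i j p * comulCoeff b p k l =
      ∑ q, comulCoeff b j k q * comulCoeff b i q l := by
  classical
  have h := congrArg (fun t => (b.tensorProduct (b.tensorProduct b)).repr t (i, j, k))
    (coassoc_apply (R := K) (b l))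
  simp only [comul_eq_sum_comulCoeff b l, map_sum, map_smul, LinearMap.rTensor_tmul,
    LinearMap.lTensor_tmul, Finsupp.finsetSum_apply, Finsupp.smul_apply, repr_assoc_tmul,
    Module.Basis.tensorProduct_repr_tmul_apply, b.repr_self, Finsupp.single_apply,
    Fintype.sum_prod_type] at h
  simpa [comulCoeff, mul_comm] using h

lemma sum_one_mul_mulCoeff [DecidableEq ι] (i j : ι) :
    ∑ e, b.repr 1 e * mulCoeff b e i j = if i = j then 1 else 0 := by
  have h : b.repr ((∑ e, b.repr 1 e • b e) * b i) j = ∑ e, b.repr 1 e * mulCoeff b e i j := by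
    simp [-Module.Basis.sum_repr, Finset.sum_mul, mulCoeff]
  rw [← h, b.sum_repr, one_mul, b.repr_self, Finsupp.single_apply]

lemma sum_one_mul_mulCoeff' [DecidableEq ι] (i j : ι) :
    ∑ e, b.repr 1 e * mulCoeff b i e j = if i = j then 1 else 0 := by
  have h : b.repr (b i * ∑ e, b.repr 1 e • b e) j = ∑ e, b.repr 1 e * mulCoeff b i e j := by
    simp [-Module.Basis.sum_repr, Finset.mul_sum, mulCoeff]
  rw [← h, b.sum_repr, mul_one, b.repr_self, Finsupp.single_apply]

lemma sum_counit_mul_comulCoeff [DecidableEq ι] (i j : ι) :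
    ∑ c, counit (R := K) (b c) * comulCoeff b c i j = if i = j then 1 else 0 := by
  have h := congrArg (fun t => b.repr (TensorProduct.lid K H t) i)
    (rTensor_counit_comul (R := K) (b j))
  simpa [comul_eq_sum_comulCoeff, Finsupp.single_apply, Fintype.sum_prod_type, mul_comm,
    eq_comm] using h

lemma sum_counit_mul_comulCoeff' [DecidableEq ι] (i j : ι) :
    ∑ c, counit (R := K) (b c) * comulCoeff b i c j = if i = j then 1 else 0 := by
  have h := congrArg (fun t => b.repr (TensorProduct.rid K H t) i)
    (lTensor_counit_comul (R := K) (b j))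
  simpa [comul_eq_sum_comulCoeff, Finsupp.single_apply, Fintype.sum_prod_type, mul_comm,
    eq_comm] using h

lemma sum_mulCoeff_mul_comulCoeff (i j k l : ι) :
    ∑ p, mulCoeff b i j p * comulCoeff b k l p = ∑ p : (ι × ι) × ι × ι,
      comulCoeff b p.1.1 p.1.2 i * comulCoeff b p.2.1 p.2.2 j *
        (mulCoeff b p.1.1 p.2.1 k * mulCoeff b p.1.2 p.2.2 l) := by
  have h : (b.tensorProduct b).repr (comul (∑ p, mulCoeff b i j p • b p)) (k, l) =
      ∑ p, mulCoeff b i j p * comulCoeff b k l p := by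
    simp [comulCoeff]
  rw [← h, ← mul_eq_sum_mulCoeff, Bialgebra.comul_mul, comul_eq_sum_comulCoeff b i,
    comul_eq_sum_comulCoeff b j, Finset.sum_mul_sum, ← Finset.sum_product',
    Finset.univ_product_univ]
  simp only [smul_mul_smul_comm, Algebra.TensorProduct.tmul_mul_tmul, map_sum, map_smul,
    Finsupp.finsetSum_apply, Finsupp.smul_apply, Module.Basis.tensorProduct_repr_tmul_apply,
    smul_eq_mul, mulCoeff, mul_comm (b.repr _ l)]

lemma sum_one_mul_comulCoeff (i j : ι) :
    ∑ e, b.repr 1 e * comulCoeff b i j e = b.repr 1 i * b.repr 1 j := by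
  have h : (b.tensorProduct b).repr (comul (∑ e, b.repr 1 e • b e)) (i, j) =
      ∑ e, b.repr 1 e * comulCoeff b i j e := by
    simp [-Module.Basis.sum_repr, comulCoeff]
  rw [← h, b.sum_repr, Bialgebra.comul_one, Algebra.TensorProduct.one_def,
    Module.Basis.tensorProduct_repr_tmul_apply, smul_eq_mul, mul_comm]

lemma sum_counit_mul_mulCoeff (i j : ι) :
    ∑ c, counit (R := K) (b c) * mulCoeff b i j c =
      counit (R := K) (b i) * counit (R := K) (b j) := by
  rw [← Bialgebra.counit_mul, mul_eq_sum_mulCoeff]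
  simp [mul_comm]

lemma sum_one_mul_counit : ∑ e, b.repr 1 e * counit (R := K) (b e) = 1 := by
  have h : counit (∑ e, b.repr 1 e • b e) = ∑ e, b.repr 1 e * counit (R := K) (b e) := by
    simp [-Module.Basis.sum_repr]
  rw [← h, b.sum_repr, Bialgebra.counit_one]

lemma sum_comulCoeff_mul_antipodeCoeff_mul_mulCoeff (k l : ι) :
    ∑ p : ι × ι × ι,
      comulCoeff b p.1 p.2.1 k * antipodeCoeff b p.1 p.2.2 * mulCoeff b p.2.2 p.2.1 l =
      counit (R := K) (b k) * b.repr 1 l := by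
  have h := congrArg (b.repr · l) (mul_antipode_rTensor_comul_apply (R := K) (b k))
  simpa [comul_eq_sum_comulCoeff b k, antipode_eq_sum_antipodeCoeff, TensorProduct.sum_tmul,
    Algebra.algebraMap_eq_smul_one, Finset.smul_sum, Fintype.sum_prod_type, mulCoeff,
    mul_assoc] using h

lemma sum_comulCoeff_mul_antipodeCoeff_mul_mulCoeff' (k l : ι) :
    ∑ p : ι × ι × ι,
      comulCoeff b p.1 p.2.1 k * antipodeCoeff b p.2.1 p.2.2 * mulCoeff b p.1 p.2.2 l =
      counit (R := K) (b k) * b.repr 1 l := by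
  have h := congrArg (b.repr · l) (mul_antipode_lTensor_comul_apply (R := K) (b k))
  simpa [comul_eq_sum_comulCoeff b k, antipode_eq_sum_antipodeCoeff, TensorProduct.tmul_sum,
    Algebra.algebraMap_eq_smul_one, Finset.smul_sum, Fintype.sum_prod_type, mulCoeff,
    mul_assoc] using h

end StructureConstants

section PositiveBasis

open Coalgebra HopfAlgebra

lemma exists_ne_zero_and_ne_zero_iff_sum_mul_ne_zero {α K : Type*} [Fintype α] [Semiring K]
    [PartialOrder K] [IsOrderedRing K] [NoZeroDivisors K] {f g : α → K} (hf : ∀ i, 0 ≤ f i)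
    (hg : ∀ i, 0 ≤ g i) : (∃ i, f i ≠ 0 ∧ g i ≠ 0) ↔ ∑ i, f i * g i ≠ 0 := by
  simp [Finset.sum_eq_zero_iff_of_nonneg fun i _ => mul_nonneg (hf i) (hg i)]

namespace IsPositiveBasis

variable {H ι : Type*} [Ring H] [HopfAlgebra ℂ H] {b : Module.Basis ι ℂ H}

lemma mulCoeff_nonneg (hb : IsPositiveBasis b) (i j k : ι) : 0 ≤ mulCoeff b i j k :=
  hb.mul_nonneg i j k

lemma comulCoeff_nonneg (hb : IsPositiveBasis b) (i j k : ι) : 0 ≤ comulCoeff b i j k :=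
  hb.comul_nonneg k i j

lemma antipodeCoeff_nonneg (hb : IsPositiveBasis b) (i j : ι) : 0 ≤ antipodeCoeff b i j :=
  hb.antipode_nonneg i j

variable [Fintype ι]

/-- The supports of the structure constants in a positive basis: since non-negative terms cannot
cancel, every identity between structure constants is inherited by their supports. -/
noncomputable def relHopf (hb : IsPositiveBasis b) : RelHopf ι where
  Mul i j k := mulCoeff b i j k ≠ 0
  Comul i j k := comulCoeff b i j k ≠ 0
  Unit i := b.repr 1 i ≠ 0
  Counit i := counit (R := ℂ) (b i) ≠ 0
  Antipode i j := antipodeCoeff b i j ≠ 0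
  assoc i j k l := by
    have hm := hb.mulCoeff_nonneg
    rw [exists_ne_zero_and_ne_zero_iff_sum_mul_ne_zero (hm i j) (hm · k l),
      exists_ne_zero_and_ne_zero_iff_sum_mul_ne_zero (hm j k) (hm i · l),
      sum_mulCoeff_mul_mulCoeff]
  coassoc i j k l := by
    have hd := hb.comulCoeff_nonneg
    rw [exists_ne_zero_and_ne_zero_iff_sum_mul_ne_zero (hd i j) (hd · k l),
      exists_ne_zero_and_ne_zero_iff_sum_mul_ne_zero (hd j k) (hd i · l),
      sum_comulCoeff_mul_comulCoeff]
  unit_mul i j := by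
    classical
    rw [exists_ne_zero_and_ne_zero_iff_sum_mul_ne_zero hb.one_nonneg (hb.mulCoeff_nonneg · i j),
      sum_one_mul_mulCoeff]
    simp
  mul_unit i j := by
    classical
    rw [exists_ne_zero_and_ne_zero_iff_sum_mul_ne_zero hb.one_nonneg (hb.mulCoeff_nonneg i · j),
      sum_one_mul_mulCoeff']
    simp
  counit_comul i j := by
    classical
    rw [exists_ne_zero_and_ne_zero_iff_sum_mul_ne_zero hb.counit_nonneg
      (hb.comulCoeff_nonneg · i j), sum_counit_mul_comulCoeff]
    simp
  comul_counit i j := by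
    classical
    rw [exists_ne_zero_and_ne_zero_iff_sum_mul_ne_zero hb.counit_nonneg
      (hb.comulCoeff_nonneg i · j), sum_counit_mul_comulCoeff']
    simp
  mul_comul i j k l := by
    have hm := hb.mulCoeff_nonneg
    have hd := hb.comulCoeff_nonneg
    have h := exists_ne_zero_and_ne_zero_iff_sum_mul_ne_zero (α := (ι × ι) × ι × ι)
      (fun p => _root_.mul_nonneg (hd p.1.1 p.1.2 i) (hd p.2.1 p.2.2 j))
      (fun p => _root_.mul_nonneg (hm p.1.1 p.2.1 k) (hm p.1.2 p.2.2 l))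
    rw [exists_ne_zero_and_ne_zero_iff_sum_mul_ne_zero (hm i j) (hd k l),
      sum_mulCoeff_mul_comulCoeff, ← h]
    simp only [mul_ne_zero_iff, Prod.exists, and_assoc]
  comul_unit i j := by
    rw [exists_ne_zero_and_ne_zero_iff_sum_mul_ne_zero hb.one_nonneg (hb.comulCoeff_nonneg i j),
      sum_one_mul_comulCoeff, mul_ne_zero_iff]
  counit_mul i j := by
    rw [exists_ne_zero_and_ne_zero_iff_sum_mul_ne_zero hb.counit_nonneg (hb.mulCoeff_nonneg i j),
      sum_counit_mul_mulCoeff, mul_ne_zero_iff]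
  counit_unit := by
    rw [exists_ne_zero_and_ne_zero_iff_sum_mul_ne_zero hb.one_nonneg hb.counit_nonneg,
      sum_one_mul_counit]
    exact one_ne_zero
  antipode_left k l := by
    have h := exists_ne_zero_and_ne_zero_iff_sum_mul_ne_zero (α := ι × ι × ι)
      (fun p => _root_.mul_nonneg (hb.comulCoeff_nonneg p.1 p.2.1 k)
        (hb.antipodeCoeff_nonneg p.1 p.2.2)) (fun p => hb.mulCoeff_nonneg p.2.2 p.2.1 l)
    rw [← mul_ne_zero_iff, ← sum_comulCoeff_mul_antipodeCoeff_mul_mulCoeff, ← h]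
    simp only [mul_ne_zero_iff, Prod.exists, and_assoc]
  antipode_right k l := by
    have h := exists_ne_zero_and_ne_zero_iff_sum_mul_ne_zero (α := ι × ι × ι)
      (fun p => _root_.mul_nonneg (hb.comulCoeff_nonneg p.1 p.2.1 k)
        (hb.antipodeCoeff_nonneg p.2.1 p.2.2)) (fun p => hb.mulCoeff_nonneg p.1 p.2.2 l)
    rw [← mul_ne_zero_iff, ← sum_comulCoeff_mul_antipodeCoeff_mul_mulCoeff', ← h]
    simp only [mul_ne_zero_iff, Prod.exists, and_assoc]

end IsPositiveBasis

end PositiveBasis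

namespace MatchedPair

variable {I J : Type*} [Group I] [Group J] (mp : MatchedPair I J)

section Trivialization

variable {A : Type*} [AddCommGroup A] [Module ℚ A]

/- The trivializations are found by averaging: `φ u` is minus the mean of `m u x` over the last
argument, and `ψ` the mean of `w` over its first argument. -/

lemma exists_trivialization_of_ract_cocycle [Finite J] (m : I → J → J → A)
    (hm : ∀ u x y z, m u x y + m u (x * y) z = m (mp.ract u x) y z + m u x (y * z)) :
    ∃ φ : I → J → A, ∀ u x y, φ u x + φ (mp.ract u x) y + m u x y = φ u (x * y) := by
  have := Fintype.ofFinite J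
  have hJ : (Fintype.card J : ℚ) ≠ 0 := by simp
  refine ⟨fun u x => -(Fintype.card J : ℚ)⁻¹ • ∑ z, m u x z, fun u x y => ?_⟩
  have hsum : (Fintype.card J : ℚ) • m u x y + ∑ z, m u (x * y) z =
      ∑ z, m (mp.ract u x) y z + ∑ z, m u x z := by
    rw [← Equiv.sum_comp (Equiv.mulLeft y) (m u x), ← Finset.sum_add_distrib]
    simp only [Equiv.coe_mulLeft, ← hm, Finset.sum_add_distrib, Finset.sum_const,
      Finset.card_univ, Nat.cast_smul_eq_nsmul]
  have hmean : m u x y = (Fintype.card J : ℚ)⁻¹ • (Fintype.card J : ℚ) • m u x y := by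
    rw [inv_smul_smul₀ hJ]
  linear_combination (norm := module) hmean + (Fintype.card J : ℚ)⁻¹ • hsum

lemma exists_trivialization_of_lact_cocycle [Finite I] (w : I → I → J → A)
    (hw : ∀ c d k x, w (c * d) k x + w c d (mp.lact k x) = w c (d * k) x + w d k x)
    (hw' : ∀ c d x y, w c d (x * y) = w c d x + w (mp.ract c (mp.lact d x)) (mp.ract d x) y) :
    ∃ ψ : I → J → A, (∀ d k x, ψ (d * k) x + w d k x = ψ d (mp.lact k x) + ψ k x) ∧
      ∀ u x y, ψ u (x * y) = ψ u x + ψ (mp.ract u x) y := by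
  have := Fintype.ofFinite I
  have hI : (Fintype.card I : ℚ) ≠ 0 := by simp
  refine ⟨fun u x => (Fintype.card I : ℚ)⁻¹ • ∑ c, w c u x, fun d k x => ?_, fun u x y => ?_⟩
  · have hsum : ∑ c, w c k x + ∑ c, w c d (mp.lact k x) =
        ∑ c, w c (d * k) x + (Fintype.card I : ℚ) • w d k x := by
      rw [← Equiv.sum_comp (Equiv.mulRight d) (w · k x), ← Finset.sum_add_distrib]
      simp only [Equiv.coe_mulRight, hw, Finset.sum_add_distrib, Finset.sum_const,
        Finset.card_univ, Nat.cast_smul_eq_nsmul]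
    have hmean : w d k x = (Fintype.card I : ℚ)⁻¹ • (Fintype.card I : ℚ) • w d k x := by
      rw [inv_smul_smul₀ hI]
    linear_combination (norm := module) hmean - (Fintype.card I : ℚ)⁻¹ • hsum
  · have hsum : ∑ c, w (mp.ract c (mp.lact u x)) (mp.ract u x) y = ∑ c, w c (mp.ract u x) y :=
      (mp.ractEquiv (mp.lact u x)).sum_comp (w · (mp.ract u x) y)
    simp only [hw', Finset.sum_add_distrib, smul_add, hsum]

lemma exists_trivialization [Finite I] [Finite J] (m : I → J → J → A) (w : I → I → J → A)
    (hm : ∀ u x y z, m u x y + m u (x * y) z = m (mp.ract u x) y z + m u x (y * z))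
    (hw : ∀ c d k x, w (c * d) k x + w c d (mp.lact k x) = w c (d * k) x + w d k x)
    (hmw : ∀ c d x y, m (c * d) x y + w c d (x * y) =
      w c d x + w (mp.ract c (mp.lact d x)) (mp.ract d x) y +
        (m c (mp.lact d x) (mp.lact (mp.ract d x) y) + m d x y)) :
    ∃ l : I → J → A, (∀ u x y, l u x + l (mp.ract u x) y + m u x y = l u (x * y)) ∧
      ∀ c d x, l (c * d) x + w c d x = l c (mp.lact d x) + l d x := by
  obtain ⟨φ, hφ⟩ := mp.exists_trivialization_of_ract_cocycle m hm
  obtain ⟨ψ, hψ, hψ'⟩ := mp.exists_trivialization_of_lact_cocycle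
    (fun c d x => w c d x + φ (c * d) x - φ c (mp.lact d x) - φ d x)
    (fun c d k x => by
      simp only [mp.mul_lact, mul_assoc]
      linear_combination (norm := module) hw c d k x)
    (fun c d x y => by
      simp only [mp.lact_mul, ← mp.mul_ract]
      linear_combination (norm := module) hmw c d x y - hφ (c * d) x y +
        hφ c (mp.lact d x) (mp.lact (mp.ract d x) y) + hφ d x y)
  refine ⟨fun u x => φ u x + ψ u x, fun u x y => ?_, fun c d x => ?_⟩
  · linear_combination (norm := module) hφ u x y - hψ' u x y
  · linear_combination (norm := module) hψ c d x

end Trivialization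

lemma exists_pos_trivialization [Finite I] [Finite J] (m : I → J → J → ℝ) (w : I → I → J → ℝ)
    (hm0 : ∀ u x y, 0 < m u x y) (hw0 : ∀ c d x, 0 < w c d x)
    (hm : ∀ u x y z, m u x y * m u (x * y) z = m (mp.ract u x) y z * m u x (y * z))
    (hw : ∀ c d k x, w (c * d) k x * w c d (mp.lact k x) = w c (d * k) x * w d k x)
    (hmw : ∀ c d x y, m (c * d) x y * w c d (x * y) =
      w c d x * w (mp.ract c (mp.lact d x)) (mp.ract d x) y *
        (m c (mp.lact d x) (mp.lact (mp.ract d x) y) * m d x y)) :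
    ∃ l : I → J → ℝ, (∀ u x, 0 < l u x) ∧
      (∀ u x y, l u x * l (mp.ract u x) y * m u x y = l u (x * y)) ∧
      ∀ c d x, l (c * d) x * w c d x = l c (mp.lact d x) * l d x := by
  have hm1 {u x y} : m u x y ≠ 0 := (hm0 u x y).ne'
  have hw1 {c d x} : w c d x ≠ 0 := (hw0 c d x).ne'
  obtain ⟨l, hl, hl'⟩ := mp.exists_trivialization (fun u x y => Real.log (m u x y))
    (fun c d x => Real.log (w c d x))
    (fun u x y z => by simp only [← Real.log_mul hm1 hm1, hm])
    (fun c d k x => by simp only [← Real.log_mul hw1 hw1, hw])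
    (fun c d x y => by
      rw [← Real.log_mul hm1 hw1, hmw, Real.log_mul (mul_ne_zero hw1 hw1)
        (mul_ne_zero hm1 hm1), Real.log_mul hw1 hw1,
        Real.log_mul hm1 hm1])
  refine ⟨fun u x => Real.exp (l u x), fun u x => Real.exp_pos _, fun u x y => ?_,
    fun c d x => ?_⟩
  · simp only [← hl, Real.exp_add, Real.exp_log (hm0 _ _ _)]
  · rw [← Real.exp_log (hw0 c d x), ← Real.exp_add, hl', Real.exp_add]

end MatchedPair

section BicrossedBasis

open Coalgebra

variable {K H I J : Type*} [CommRing K] [Ring H] [HopfAlgebra K H] [Group I] [Group J]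
  (mp : MatchedPair I J) (e : Module.Basis (I × J) K H)

/-- A basis indexed by the arrows of a matched pair of groups on which the bialgebra operations are
those of the associated bicrossproduct. -/
structure IsBicrossedBasis [Fintype I] : Prop where
  mul_eq_ite (u v : I) (x y : J) [Decidable (mp.ract u x = v)] :
    e (u, x) * e (v, y) = if mp.ract u x = v then e (u, x * y) else 0
  comul (u : I) (x : J) :
    comul (R := K) (e (u, x)) = ∑ h, e (u * h⁻¹, mp.lact h x) ⊗ₜ[K] e (h, x)

/-- A basis indexed by the arrows of a matched pair of groups whose structure constants are
non-zero at the same places as those of the associated bicrossproduct. -/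
structure HasBicrossedSupport : Prop where
  mul_ne_zero_iff {u v t : I} {x y z : J} :
    mulCoeff e (u, x) (v, y) (t, z) ≠ 0 ↔ mp.ract u x = v ∧ t = u ∧ z = x * y
  comul_ne_zero_iff {c d t : I} {y z x : J} :
    comulCoeff e (c, y) (d, z) (t, x) ≠ 0 ↔ y = mp.lact d z ∧ t = c * d ∧ x = z

/-- The structure constants of the multiplication which do not vanish when `e` has bicrossed
support. -/
noncomputable def mulWeight (u : I) (x y : J) : K :=
  mulCoeff e (u, x) (mp.ract u x, y) (u, x * y)

/-- The structure constants of the comultiplication which do not vanish when `e` has bicrossed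
support. -/
noncomputable def comulWeight (c d : I) (x : J) : K :=
  comulCoeff e (c, mp.lact d x) (d, x) (c * d, x)

namespace HasBicrossedSupport

variable {mp e}

variable (he : HasBicrossedSupport mp e)
include he

lemma mulWeight_ne_zero (u : I) (x y : J) : mulWeight mp e u x y ≠ 0 :=
  he.mul_ne_zero_iff.2 ⟨rfl, rfl, rfl⟩

lemma comulWeight_ne_zero (c d : I) (x : J) : comulWeight mp e c d x ≠ 0 :=
  he.comul_ne_zero_iff.2 ⟨rfl, rfl, rfl⟩

variable [Finite J]

lemma mul_eq_ite [Finite I] (u v : I) (x y : J) [Decidable (mp.ract u x = v)] :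
    e (u, x) * e (v, y) = if mp.ract u x = v then mulWeight mp e u x y • e (u, x * y) else 0 := by
  have := Fintype.ofFinite I
  have := Fintype.ofFinite J
  rw [mul_eq_sum_mulCoeff]
  split_ifs with h
  · subst h
    refine Fintype.sum_eq_single _ fun ⟨t, z⟩ hne => ?_
    contrapose! hne
    obtain ⟨-, rfl, rfl⟩ := he.mul_ne_zero_iff.1 (left_ne_zero_of_smul hne)
    rfl
  · refine Fintype.sum_eq_zero _ fun ⟨t, z⟩ => ?_
    contrapose! h
    exact (he.mul_ne_zero_iff.1 (left_ne_zero_of_smul h)).1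

lemma comul_eq_sum [Fintype I] (u : I) (x : J) : comul (R := K) (e (u, x)) =
    ∑ h, comulWeight mp e (u * h⁻¹) h x • e (u * h⁻¹, mp.lact h x) ⊗ₜ[K] e (h, x) := by
  have := Fintype.ofFinite J
  let f : I → (I × J) × I × J := fun h => ((u * h⁻¹, mp.lact h x), h, x)
  have hf : Function.Injective f := fun h k hk => congrArg (fun p => p.2.1) hk
  rw [comul_eq_sum_comulCoeff]
  refine (Fintype.sum_of_injective f hf _ _ ?_ fun h => ?_).symm
  · rintro ⟨⟨c, y⟩, d, z⟩ hp
    contrapose! hp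
    obtain ⟨rfl, rfl, rfl⟩ := he.comul_ne_zero_iff.1 (left_ne_zero_of_smul hp)
    exact ⟨d, by simp [f]⟩
  · simp [f, comulWeight]

lemma mulWeight_cocycle [Finite I] (u : I) (x y z : J) :
    mulWeight mp e u x y * mulWeight mp e u (x * y) z =
      mulWeight mp e (mp.ract u x) y z * mulWeight mp e u x (y * z) := by
  have := Fintype.ofFinite I
  have := Fintype.ofFinite J
  have h := sum_mulCoeff_mul_mulCoeff e (u, x) (mp.ract u x, y)
    (mp.ract u (x * y), z) (u, x * y * z)
  rw [Fintype.sum_eq_single (u, x * y), Fintype.sum_eq_single (mp.ract u x, y * z)] at h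
  · simpa only [mulWeight, mp.ract_mul, mul_assoc] using h
  · rintro ⟨v, t⟩ hne
    contrapose! hne
    obtain ⟨-, rfl, rfl⟩ := he.mul_ne_zero_iff.1 (left_ne_zero_of_mul hne)
    rfl
  · rintro ⟨v, t⟩ hne
    contrapose! hne
    obtain ⟨-, rfl, rfl⟩ := he.mul_ne_zero_iff.1 (left_ne_zero_of_mul hne)
    rfl

lemma comulWeight_cocycle [Finite I] (c d k : I) (x : J) :
    comulWeight mp e (c * d) k x * comulWeight mp e c d (mp.lact k x) =
      comulWeight mp e c (d * k) x * comulWeight mp e d k x := by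
  have := Fintype.ofFinite I
  have := Fintype.ofFinite J
  have h := sum_comulCoeff_mul_comulCoeff e (c, mp.lact (d * k) x) (d, mp.lact k x) (k, x)
    (c * d * k, x)
  rw [Fintype.sum_eq_single (c * d, mp.lact k x), Fintype.sum_eq_single (d * k, x)] at h
  · rw [mul_comm, mul_comm (comulWeight mp e c _ x)]
    simpa only [comulWeight, mp.mul_lact, mul_assoc] using h
  · rintro ⟨v, t⟩ hne
    contrapose! hne
    obtain ⟨-, rfl, rfl⟩ := he.comul_ne_zero_iff.1 (left_ne_zero_of_mul hne)
    rfl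
  · rintro ⟨v, t⟩ hne
    contrapose! hne
    obtain ⟨-, rfl, rfl⟩ := he.comul_ne_zero_iff.1 (left_ne_zero_of_mul hne)
    rfl

lemma mulWeight_mul_comulWeight [Finite I] (c d : I) (x y : J) :
    mulWeight mp e (c * d) x y * comulWeight mp e c d (x * y) =
      comulWeight mp e c d x * comulWeight mp e (mp.ract c (mp.lact d x)) (mp.ract d x) y *
        (mulWeight mp e c (mp.lact d x) (mp.lact (mp.ract d x) y) * mulWeight mp e d x y) := by
  have := Fintype.ofFinite I
  have := Fintype.ofFinite J
  have h := sum_mulCoeff_mul_comulCoeff e (c * d, x) (mp.ract (c * d) x, y)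
    (c, mp.lact d (x * y)) (d, x * y)
  rw [Fintype.sum_eq_single (c * d, x * y), Fintype.sum_eq_single
    (((c, mp.lact d x), d, x),
      (mp.ract c (mp.lact d x), mp.lact (mp.ract d x) y), mp.ract d x, y)] at h
  · simpa only [mulWeight, comulWeight, mp.mul_ract, mp.lact_mul] using h
  · rintro ⟨⟨⟨c₁, x₁⟩, d₁, y₁⟩, ⟨c₂, x₂⟩, d₂, y₂⟩ hne
    contrapose! hne
    have hd := left_ne_zero_of_mul hne
    have hm := right_ne_zero_of_mul hne
    obtain ⟨rfl, -, rfl⟩ := he.comul_ne_zero_iff.1 (left_ne_zero_of_mul hd)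
    obtain ⟨rfl, -, rfl⟩ := he.comul_ne_zero_iff.1 (right_ne_zero_of_mul hd)
    obtain ⟨rfl, rfl, -⟩ := he.mul_ne_zero_iff.1 (left_ne_zero_of_mul hm)
    obtain ⟨rfl, rfl, -⟩ := he.mul_ne_zero_iff.1 (right_ne_zero_of_mul hm)
    rfl
  · rintro ⟨v, t⟩ hne
    contrapose! hne
    obtain ⟨-, rfl, rfl⟩ := he.mul_ne_zero_iff.1 (left_ne_zero_of_mul hne)
    rfl

end HasBicrossedSupport

end BicrossedBasis

section Rescaling

variable {M ι κ μ : Type*} [AddCommGroup M] [Module ℂ M] {b : Module.Basis ι ℂ M}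
  {e : Module.Basis κ ℂ M}

/-- The basis `e` consists of positive multiples of the elements of `b`. Positivity of structure
constants does not distinguish between such bases. -/
def IsRescaling (b : Module.Basis ι ℂ M) (e : Module.Basis κ ℂ M) : Prop :=
  ∃ (f : κ ≃ ι) (l : κ → ℂ), (∀ p, 0 < l p) ∧ ∀ p, e p = l p • b (f p)

lemma isRescaling_reindex (b : Module.Basis ι ℂ M) (f : ι ≃ κ) : IsRescaling b (b.reindex f) :=
  ⟨f.symm, 1, fun _ => one_pos, fun p => by simp⟩

lemma isRescaling_isUnitSMul (b : Module.Basis ι ℂ M) {l : ι → ℂ} (hl : ∀ i, 0 < l i) :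
    IsRescaling b (b.isUnitSMul fun i => (hl i).ne'.isUnit) :=
  ⟨Equiv.refl ι, l, hl, fun i => b.isUnitSMul_apply _ i⟩

namespace IsRescaling

lemma trans {d : Module.Basis μ ℂ M} (h : IsRescaling b e) (h' : IsRescaling e d) :
    IsRescaling b d := by
  obtain ⟨f, l, hl, hbe⟩ := h
  obtain ⟨g, r, hr, hed⟩ := h'
  exact ⟨g.trans f, fun p => r p * l (g p), fun p => mul_pos (hr p) (hl _), fun p => by
    rw [hed, hbe, smul_smul, Equiv.trans_apply]⟩

lemma tensorProduct (h : IsRescaling b e) :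
    IsRescaling (b.tensorProduct b) (e.tensorProduct e) := by
  obtain ⟨f, l, hl, hbe⟩ := h
  refine ⟨f.prodCongr f, fun p => l p.1 * l p.2, fun p => mul_pos (hl _) (hl _), fun p => ?_⟩
  simp only [Module.Basis.tensorProduct_apply', hbe, TensorProduct.smul_tmul_smul]
  rfl

lemma repr_nonneg (h : IsRescaling b e) {t : M} (ht : ∀ i, 0 ≤ b.repr t i) (p : κ) :
    0 ≤ e.repr t p := by
  obtain ⟨f, l, hl, hbe⟩ := h
  have hcoord : b.coord (f p) = l p • e.coord p := e.ext fun q => by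
    rw [LinearMap.smul_apply, e.coord_apply, e.repr_self, b.coord_apply, hbe, map_smul,
      b.repr_self]
    obtain rfl | hqp := eq_or_ne q p
    · simp
    · simp [hqp, f.injective.ne hqp]
  have hrepr : e.repr t p = (l p)⁻¹ * b.repr t (f p) :=
    (eq_inv_mul_iff_mul_eq₀ (hl p).ne').2 (LinearMap.congr_fun hcoord t).symm
  rw [hrepr]
  exact mul_nonneg (RCLike.inv_pos.2 (hl p)).le (ht _)

end IsRescaling

variable {H : Type*} [Ring H] [HopfAlgebra ℂ H] {b : Module.Basis ι ℂ H} {e : Module.Basis κ ℂ H}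

lemma IsPositive.of_isRescaling {R : H ⊗[ℂ] H} (hR : IsPositive b R) (h : IsRescaling b e) :
    IsPositive e R :=
  fun _ _ => h.tensorProduct.repr_nonneg (fun p => hR p.1 p.2) _

lemma IsRescaling.isPositiveBasis (h : IsRescaling b e) (hb : IsPositiveBasis b) :
    IsPositiveBasis e := by
  obtain ⟨f, l, hl, hbe⟩ := id h
  exact
    { mul_nonneg i j := h.repr_nonneg fun k => by
        rw [hbe, hbe, smul_mul_smul_comm, map_smul]
        exact mul_nonneg (mul_nonneg (hl i).le (hl j).le) (hb.mul_nonneg ..)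
      one_nonneg := h.repr_nonneg hb.one_nonneg
      comul_nonneg i _ _ := h.tensorProduct.repr_nonneg (fun p => by
        rw [hbe, map_smul, map_smul]
        exact mul_nonneg (hl i).le (hb.comul_nonneg ..)) _
      counit_nonneg i := by
        rw [hbe, map_smul]
        exact mul_nonneg (hl i).le (hb.counit_nonneg _)
      antipode_nonneg i := h.repr_nonneg fun j => by
        rw [hbe, map_smul, map_smul]
        exact mul_nonneg (hl i).le (hb.antipode_nonneg ..) }

end Rescaling

section BicrossedBasis

open Coalgebra

variable {H I J : Type*} [Ring H] [Group I] [Group J] {mp : MatchedPair I J}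

namespace IsBicrossedBasis

variable {K : Type*} [CommRing K] [HopfAlgebra K H] [Fintype I] {e : Module.Basis (I × J) K H}
  (he : IsBicrossedBasis mp e)
include he

lemma counit_eq_ite [DecidableEq I] (u : I) (x : J) :
    counit (R := K) (e (u, x)) = if u = 1 then 1 else 0 := by
  classical
  have h := congrArg (fun t => e.repr (TensorProduct.lid K H t) (1, x))
    (rTensor_counit_comul (R := K) (e (u, x)))
  simp only [he.comul, map_sum, LinearMap.rTensor_tmul, TensorProduct.lid_tmul, map_smul,
    e.repr_self, Finsupp.finsetSum_apply, Finsupp.smul_apply, Finsupp.single_apply, one_smul,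
    Prod.mk.injEq, and_true, smul_eq_mul, mul_ite, mul_one, mul_zero, Finset.sum_ite_eq',
    Finset.mem_univ, if_true, inv_one, mp.one_lact] at h
  exact h

end IsBicrossedBasis

lemma HasBicrossedSupport.isBicrossedBasis_isUnitSMul {K : Type*} [CommRing K] [HopfAlgebra K H]
    [Fintype I] [Finite J] {e : Module.Basis (I × J) K H} (he : HasBicrossedSupport mp e)
    {l : I → J → K} (hl : ∀ p : I × J, IsUnit (l p.1 p.2))
    (hlm : ∀ u x y, l u x * l (mp.ract u x) y * mulWeight mp e u x y = l u (x * y))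
    (hlw : ∀ c d x, l (c * d) x * comulWeight mp e c d x = l c (mp.lact d x) * l d x) :
    IsBicrossedBasis mp (e.isUnitSMul hl) where
  mul_eq_ite u v x y _ := by
    simp only [e.isUnitSMul_apply, smul_mul_smul_comm, he.mul_eq_ite]
    split_ifs with h
    · rw [smul_smul, ← h, hlm]
    · rw [smul_zero]
  comul u x := by
    simp only [e.isUnitSMul_apply, map_smul, he.comul_eq_sum, Finset.smul_sum, smul_smul,
      TensorProduct.smul_tmul_smul, ← hlw, inv_mul_cancel_right]

namespace IsPositiveBasis

variable [HopfAlgebra ℂ H] {ι : Type*}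

lemma hasBicrossedSupport [Fintype ι] {b : Module.Basis ι ℂ H} (hb : IsPositiveBasis b) :
    HasBicrossedSupport hb.relHopf.matchedPair (b.reindex hb.relHopf.arrow.symm) where
  mul_ne_zero_iff := by
    intros
    rw [← RelHopf.mul_arrow_iff, mulCoeff_reindex]
    rfl
  comul_ne_zero_iff := by
    intros
    rw [← RelHopf.comul_arrow_iff, comulCoeff_reindex]
    rfl

lemma exists_isBicrossedBasis_of_hasBicrossedSupport [Fintype I] [Finite J]
    {e : Module.Basis (I × J) ℂ H} (hb : IsPositiveBasis e) (he : HasBicrossedSupport mp e) :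
    ∃ e' : Module.Basis (I × J) ℂ H, IsBicrossedBasis mp e' ∧ IsRescaling e e' := by
  choose m hm0 hm using fun u x y => RCLike.pos_iff_exists_ofReal.1
    ((hb.mulCoeff_nonneg ..).lt_of_ne' (he.mulWeight_ne_zero u x y))
  choose w hw0 hw using fun c d x => RCLike.pos_iff_exists_ofReal.1
    ((hb.comulCoeff_nonneg ..).lt_of_ne' (he.comulWeight_ne_zero c d x))
  replace hm u x y : mulWeight mp e u x y = m u x y := (hm u x y).symm
  replace hw c d x : comulWeight mp e c d x = w c d x := (hw c d x).symm
  obtain ⟨l, hl0, hlm, hlw⟩ := mp.exists_pos_trivialization m w hm0 hw0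
    (fun u x y z => by simpa only [hm, ← Complex.ofReal_mul, Complex.ofReal_inj] using
      he.mulWeight_cocycle u x y z)
    (fun c d k x => by simpa only [hw, ← Complex.ofReal_mul, Complex.ofReal_inj] using
      he.comulWeight_cocycle c d k x)
    (fun c d x y => by simpa only [hm, hw, ← Complex.ofReal_mul, Complex.ofReal_inj] using
      he.mulWeight_mul_comulWeight c d x y)
  have hl p : 0 < (l (Prod.fst p) (Prod.snd p) : ℂ) := Complex.zero_lt_real.2 (hl0 p.1 p.2)
  refine ⟨e.isUnitSMul fun p => (hl p).ne'.isUnit,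
    he.isBicrossedBasis_isUnitSMul (l := fun u x => (l u x : ℂ)) _ (fun u x y => ?_)
      fun c d x => ?_, isRescaling_isUnitSMul e hl⟩
  · rw [hm, ← hlm]
    push_cast
    rfl
  · rw [hw]
    exact_mod_cast hlw c d x

theorem exists_isBicrossedBasis [Finite ι] {b : Module.Basis ι ℂ H} (hb : IsPositiveBasis b) :
    ∃ (I J : Type) (_ : Group I) (_ : Group J) (_ : Fintype I) (_ : Fintype J)
      (mp : MatchedPair I J) (e : Module.Basis (I × J) ℂ H),
      IsBicrossedBasis mp e ∧ IsRescaling b e := by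
  obtain ⟨n, ⟨f⟩⟩ := Finite.exists_equiv_fin ι
  have hfb := isRescaling_reindex b f
  have hb' := hfb.isPositiveBasis hb
  have hgb := hfb.trans (isRescaling_reindex (b.reindex f) hb'.relHopf.arrow.symm)
  obtain ⟨e, he, hge⟩ := (hgb.isPositiveBasis hb).exists_isBicrossedBasis_of_hasBicrossedSupport
    hb'.hasBicrossedSupport
  exact ⟨_, _, inferInstance, inferInstance, inferInstance, inferInstance, _, e, he, hgb.trans hge⟩

end IsPositiveBasis

end BicrossedBasis

section GroupoidBasis

variable {K X Y M N A B : Type*} [CommRing K] [Ring A] [Algebra K A] [Ring B] [Algebra K B]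
  {E : Module.Basis (X × M) K A} {F : Module.Basis (Y × N) K B}

section ArrowSum

variable [Fintype X]

/-- The linear combination of basis elements `E (p, f p)`, one for each `p`. When `E` is indexed by
the arrows of an action groupoid, this is a weighted sum over a section of the source map. -/
noncomputable def arrowSum (E : Module.Basis (X × M) K A) (r : X → K) (f : X → M) : A :=
  ∑ p, r p • E (p, f p)

lemma repr_arrowSum [DecidableEq M] (r : X → K) (f : X → M) (p : X) (x : M) :
    E.repr (arrowSum E r f) (p, x) = if f p = x then r p else 0 := by
  classical
  rw [arrowSum, map_sum, Finsupp.finsetSum_apply, Fintype.sum_eq_single p fun q hq => ?_]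
  · simp [Finsupp.single_apply]
  · simp [hq]

lemma arrowSum_congr {r s : X → K} {f g : X → M} (hr : ∀ p, r p = s p)
    (hf : ∀ p, s p ≠ 0 → f p = g p) : arrowSum E r f = arrowSum E s g := by
  refine Finset.sum_congr rfl fun p _ => ?_
  rw [hr]
  by_cases hp : s p = 0
  · rw [hp, zero_smul, zero_smul]
  · rw [hf p hp]

lemma eq_and_eq_of_arrowSum_eq {r s : X → K} {f g : X → M}
    (h : arrowSum E r f = arrowSum E s g) (p : X) : r p = s p ∧ (r p ≠ 0 → f p = g p) := by
  classical
  have hcoeff (x : M) : (if f p = x then r p else 0) = if g p = x then s p else 0 := by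
    rw [← repr_arrowSum (E := E), h, repr_arrowSum]
  by_cases hfg : g p = f p
  · exact ⟨by simpa [hfg] using hcoeff (f p), fun _ => hfg.symm⟩
  · have hr : r p = 0 := by simpa [hfg] using hcoeff (f p)
    have hs : s p = 0 := by simpa [Ne.symm hfg] using (hcoeff (g p)).symm
    exact ⟨hr.trans hs.symm, fun h0 => absurd hr h0⟩

end ArrowSum

/-- A basis indexed by the arrows `p ⟶ act p x` of the action groupoid of a right action, which
multiply by composition. -/
structure IsGroupoidBasis [Monoid M] (act : X → M → X) (E : Module.Basis (X × M) K A) : Prop where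
  act_one (p : X) : act p 1 = p
  act_mul (p : X) (x y : M) : act p (x * y) = act (act p x) y
  mul_eq_ite (p q : X) (x y : M) [Decidable (act p x = q)] :
    E (p, x) * E (q, y) = if act p x = q then E (p, x * y) else 0

/-- The tensor product of two bases indexed by arrows, indexed by the pairs of arrows with the
sources split off. -/
noncomputable def arrowTensor (E : Module.Basis (X × M) K A) (F : Module.Basis (Y × N) K B) :
    Module.Basis ((X × Y) × (M × N)) K (A ⊗[K] B) :=
  (E.tensorProduct F).reindex (Equiv.prodProdProdComm X M Y N)

@[simp]
lemma arrowTensor_apply (p : X × Y) (x : M × N) :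
    arrowTensor E F (p, x) = E (p.1, x.1) ⊗ₜ[K] F (p.2, x.2) := by
  simp [arrowTensor, Module.Basis.tensorProduct_apply]

lemma arrowTensor_repr (t : A ⊗[K] B) (p : X × Y) (x : M × N) :
    (arrowTensor E F).repr t (p, x) = (E.tensorProduct F).repr t ((p.1, x.1), p.2, x.2) := by
  simp [arrowTensor]

lemma map_arrowSum [Fintype X] {F : Module.Basis (X × M) K B} {φ : A →ₗ[K] B}
    (hφ : ∀ p, φ (E p) = F p) (r : X → K) (f : X → M) :
    φ (arrowSum E r f) = arrowSum F r f := by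
  simp only [arrowSum, map_sum, map_smul, hφ]

lemma comm_arrowSum [Fintype X] [Fintype Y] (r : X × Y → K) (f : X × Y → M × N) :
    TensorProduct.comm K A B (arrowSum (arrowTensor E F) r f) =
      arrowSum (arrowTensor F E) (fun p => r p.swap) (fun p => (f p.swap).swap) := by
  rw [arrowSum, map_sum]
  exact Fintype.sum_equiv (Equiv.prodComm X Y) _ _ fun p => by simp

namespace IsGroupoidBasis

lemma arrowTensor [Monoid M] [Monoid N] {act : X → M → X} {act' : Y → N → Y}
    (hE : IsGroupoidBasis act E) (hF : IsGroupoidBasis act' F) :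
    IsGroupoidBasis (fun p x => (act p.1 x.1, act' p.2 x.2)) (arrowTensor E F) where
  act_one p := by simp [hE.act_one, hF.act_one]
  act_mul p x y := by simp [hE.act_mul, hF.act_mul]
  mul_eq_ite p q x y _ := by
    classical
    simp only [arrowTensor_apply, Algebra.TensorProduct.tmul_mul_tmul, hE.mul_eq_ite,
      hF.mul_eq_ite, Prod.ext_iff]
    split_ifs <;> simp_all

section Monoid

variable [Monoid M] [Fintype X] {act : X → M → X} (hE : IsGroupoidBasis act E)
include hE

lemma arrowSum_mul_arrowSum (r s : X → K) (f g : X → M) :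
    arrowSum E r f * arrowSum E s g =
      arrowSum E (fun p => r p * s (act p (f p))) (fun p => f p * g (act p (f p))) := by
  classical
  rw [arrowSum, arrowSum, arrowSum, Finset.sum_mul]
  refine Finset.sum_congr rfl fun p _ => ?_
  rw [Finset.mul_sum, Fintype.sum_eq_single (act p (f p)) fun q hq => ?_]
  · rw [smul_mul_smul_comm, hE.mul_eq_ite, if_pos rfl]
  · rw [smul_mul_smul_comm, hE.mul_eq_ite, if_neg hq.symm, smul_zero]

lemma one_eq_arrowSum : (1 : A) = arrowSum E 1 1 := by
  classical
  have hunit : LinearMap.mulLeft K (arrowSum E 1 1) = LinearMap.id := E.ext fun ⟨q, y⟩ => by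
    simp [arrowSum, Finset.sum_mul, hE.mul_eq_ite, hE.act_one]
  simpa using (LinearMap.congr_fun hunit 1).symm

end Monoid

section Group

variable [Group M] {act : X → M → X} (hE : IsGroupoidBasis act E)
include hE

lemma repr_mul [Fintype M] (a a' : A) (p : X) (x : M) :
    E.repr (a * a') (p, x) = ∑ g, E.repr a (p, g) * E.repr a' (act p g, g⁻¹ * x) := by
  classical
  have hbilin : (LinearMap.mul K A).compr₂ (E.coord (p, x)) = ∑ g, (LinearMap.mul K K).compl₁₂
      (E.coord (p, g)) (E.coord (act p g, g⁻¹ * x)) := by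
    refine E.ext fun ⟨q, y⟩ => E.ext fun ⟨q', y'⟩ => ?_
    simp only [LinearMap.compr₂_apply, LinearMap.mul_apply', LinearMap.sum_apply,
      LinearMap.compl₁₂_apply, E.coord_apply, E.repr_self, hE.mul_eq_ite]
    rw [Fintype.sum_eq_single y fun g hg => by simp [hg.symm]]
    by_cases hq : q = p
    · by_cases hq' : act p y = q' <;>
        simp [hq, hq', Finsupp.single_apply, eq_inv_mul_iff_mul_eq]
    · split_ifs <;> simp [hq]
  simpa using LinearMap.congr_fun₂ hbilin _ _

/-- Positivity prevents cancellation in `a * a' = 1` and `a' * a = 1`, so that `a` involves exactly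
one arrow from each source. -/
lemma exists_eq_arrowSum_of_mul_eq_one [Fintype X] [Finite M] [NoZeroDivisors K] [Nontrivial K]
    [PartialOrder K] [IsOrderedRing K] {a a' : A} (ha : ∀ p, 0 ≤ E.repr a p)
    (ha' : ∀ p, 0 ≤ E.repr a' p) (h : a * a' = 1) (h' : a' * a = 1) :
    ∃ (r : X → K) (f : X → M), (∀ p, 0 < r p) ∧ a = arrowSum E r f := by
  classical
  have := Fintype.ofFinite M
  have hone (p : X) (x : M) : E.repr 1 (p, x) = if 1 = x then 1 else 0 := by
    rw [hE.one_eq_arrowSum, repr_arrowSum, Pi.one_apply, Pi.one_apply]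
  have hexists (p : X) : ∃ g, E.repr a (p, g) ≠ 0 ∧ E.repr a' (act p g, g⁻¹) ≠ 0 := by
    have hsum := hE.repr_mul a a' p 1
    rw [h, hone, if_pos rfl] at hsum
    obtain ⟨g, -, hg⟩ := Finset.exists_ne_zero_of_sum_ne_zero (hsum ▸ one_ne_zero)
    rw [mul_one] at hg
    exact ⟨g, left_ne_zero_of_mul hg, right_ne_zero_of_mul hg⟩
  choose f hf hf' using hexists
  have hunique (p : X) (k : M) (hk : f p ≠ k) : E.repr a (p, k) = 0 := by
    have hsum := hE.repr_mul a' a (act p (f p)) ((f p)⁻¹ * k)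
    rw [h', hone, if_neg (by rwa [eq_inv_mul_iff_mul_eq, mul_one]), eq_comm,
      Finset.sum_eq_zero_iff_of_nonneg fun _ _ => mul_nonneg (ha' _) (ha _)] at hsum
    have hterm := hsum (f p)⁻¹ (Finset.mem_univ _)
    rw [← hE.act_mul, mul_inv_cancel, hE.act_one, inv_inv, mul_inv_cancel_left] at hterm
    exact (mul_eq_zero.1 hterm).resolve_left (hf' p)
  refine ⟨fun p => E.repr a (p, f p), f, fun p => (ha _).lt_of_ne' (hf p),
    E.ext_elem fun ⟨p, k⟩ => ?_⟩
  rw [repr_arrowSum]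
  split_ifs with hk
  · rw [hk]
  · exact hunique p k hk

end Group

end IsGroupoidBasis

end GroupoidBasis

section BicrossedSums

variable {K H I J : Type*} [CommRing K] [Ring H] [HopfAlgebra K H] [Group I] [Group J] [Fintype I]
  {mp : MatchedPair I J} {e : Module.Basis (I × J) K H}

namespace IsBicrossedBasis

variable (he : IsBicrossedBasis mp e)
include he

lemma isGroupoidBasis : IsGroupoidBasis mp.ract e :=
  ⟨mp.ract_one, mp.ract_mul, he.mul_eq_ite⟩

lemma isGroupoidBasis₂ :
    IsGroupoidBasis (fun p x => (mp.ract p.1 x.1, mp.ract p.2 x.2)) (arrowTensor e e) :=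
  he.isGroupoidBasis.arrowTensor he.isGroupoidBasis

lemma isGroupoidBasis₃ : IsGroupoidBasis
    (fun p x => (mp.ract p.1 x.1, mp.ract p.2.1 x.2.1, mp.ract p.2.2 x.2.2))
    (arrowTensor e (arrowTensor e e)) :=
  he.isGroupoidBasis.arrowTensor he.isGroupoidBasis₂

lemma comul_eq_arrowSum [DecidableEq I] (k : I) (x : J) : Coalgebra.comul (R := K) (e (k, x)) =
    arrowSum (arrowTensor e e) (fun p => if p.1 * p.2 = k then 1 else 0)
      (fun p => (mp.lact p.2 x, x)) := by
  rw [he.comul, arrowSum, Fintype.sum_prod_type_right]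
  refine Finset.sum_congr rfl fun v _ => ?_
  rw [Fintype.sum_eq_single (k * v⁻¹) fun u hu => ?_]
  · simp
  · rw [if_neg fun h => hu (eq_mul_inv_of_mul_eq h), zero_smul]

lemma rTensor_comul_arrowSum (r : I × I → K) (f : I × I → J × J) :
    TensorProduct.assoc K H H H (Coalgebra.comul.rTensor H (arrowSum (arrowTensor e e) r f)) =
      arrowSum (arrowTensor e (arrowTensor e e)) (fun p => r (p.1 * p.2.1, p.2.2))
        (fun p => (mp.lact p.2.1 (f (p.1 * p.2.1, p.2.2)).1, f (p.1 * p.2.1, p.2.2))) := by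
  simp only [arrowSum, map_sum, map_smul, arrowTensor_apply, LinearMap.rTensor_tmul, he.comul,
    TensorProduct.sum_tmul, TensorProduct.assoc_tmul, Finset.smul_sum]
  rw [← Fintype.sum_prod_type']
  exact Finset.sum_nbij' (fun q => (q.1.1 * q.2⁻¹, q.2, q.1.2))
    (fun p => ((p.1 * p.2.1, p.2.2), p.2.1)) (by simp) (by simp) (by simp) (by simp) (by simp)

lemma lTensor_comul_arrowSum (r : I × I → K) (f : I × I → J × J) :
    Coalgebra.comul.lTensor H (arrowSum (arrowTensor e e) r f) =
      arrowSum (arrowTensor e (arrowTensor e e)) (fun p => r (p.1, p.2.1 * p.2.2))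
        (fun p => ((f (p.1, p.2.1 * p.2.2)).1, mp.lact p.2.2 (f (p.1, p.2.1 * p.2.2)).2,
          (f (p.1, p.2.1 * p.2.2)).2)) := by
  simp only [arrowSum, map_sum, map_smul, arrowTensor_apply, LinearMap.lTensor_tmul, he.comul,
    TensorProduct.tmul_sum, Finset.smul_sum]
  rw [← Fintype.sum_prod_type']
  exact Finset.sum_nbij' (fun q => (q.1.1, q.1.2 * q.2⁻¹, q.2))
    (fun p => ((p.1, p.2.1 * p.2.2), p.2.2)) (by simp) (by simp) (by simp) (by simp) (by simp)

lemma lTensor_includeRight_arrowSum (r : I × I → K) (f : I × I → J × J) :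
    (Algebra.TensorProduct.includeRight (R := K) (A := H) (B := H)).toLinearMap.lTensor H
        (arrowSum (arrowTensor e e) r f) =
      arrowSum (arrowTensor e (arrowTensor e e)) (fun p => r (p.1, p.2.2))
        (fun p => ((f (p.1, p.2.2)).1, 1, (f (p.1, p.2.2)).2)) := by
  simp only [arrowSum, map_sum, map_smul, arrowTensor_apply, LinearMap.lTensor_tmul,
    AlgHom.toLinearMap_apply, Algebra.TensorProduct.includeRight_apply,
    he.isGroupoidBasis.one_eq_arrowSum, Pi.one_apply, one_smul, TensorProduct.tmul_sum,
    TensorProduct.sum_tmul, Finset.smul_sum, Fintype.sum_prod_type]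
  exact Finset.sum_congr rfl fun u _ => Finset.sum_comm

lemma one_tmul_arrowSum (r : I × I → K) (f : I × I → J × J) :
    (1 : H) ⊗ₜ[K] arrowSum (arrowTensor e e) r f =
      arrowSum (arrowTensor e (arrowTensor e e)) (fun p => r p.2) (fun p => (1, f p.2)) := by
  simp only [arrowSum, he.isGroupoidBasis.one_eq_arrowSum, arrowTensor_apply, Pi.one_apply,
    one_smul, TensorProduct.tmul_sum, TensorProduct.sum_tmul, TensorProduct.tmul_smul,
    Finset.smul_sum, Fintype.sum_prod_type_right (α₂ := I × I)]

lemma assoc_arrowSum_tmul_one (r : I × I → K) (f : I × I → J × J) :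
    TensorProduct.assoc K H H H (arrowSum (arrowTensor e e) r f ⊗ₜ[K] (1 : H)) =
      arrowSum (arrowTensor e (arrowTensor e e)) (fun p => r (p.1, p.2.1))
        (fun p => ((f (p.1, p.2.1)).1, (f (p.1, p.2.1)).2, 1)) := by
  simp only [arrowSum, he.isGroupoidBasis.one_eq_arrowSum, arrowTensor_apply, Pi.one_apply,
    one_smul, TensorProduct.tmul_sum, TensorProduct.sum_tmul, map_sum,
    ← TensorProduct.smul_tmul', map_smul, TensorProduct.assoc_tmul, Fintype.sum_prod_type]
  rw [Finset.sum_comm]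
  exact Finset.sum_congr rfl fun u _ => Finset.sum_comm

lemma lid_rTensor_counit_arrowSum (r : I × I → K) (f : I × I → J × J) :
    TensorProduct.lid K H (Coalgebra.counit.rTensor H (arrowSum (arrowTensor e e) r f)) =
      arrowSum e (fun v => r (1, v)) (fun v => (f (1, v)).2) := by
  classical
  simp [arrowSum, he.counit_eq_ite, Fintype.sum_prod_type_right]

lemma rid_lTensor_counit_arrowSum (r : I × I → K) (f : I × I → J × J) :
    TensorProduct.rid K H (Coalgebra.counit.lTensor H (arrowSum (arrowTensor e e) r f)) =
      arrowSum e (fun u => r (u, 1)) (fun u => (f (u, 1)).1) := by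
  classical
  simp [arrowSum, he.counit_eq_ite, Fintype.sum_prod_type]

end IsBicrossedBasis

end BicrossedSums

section MulAntipode

variable {K H : Type*} [CommRing K] [Ring H] [HopfAlgebra K H]

/-- The linear map `a ⊗ b ⊗ c ↦ a S(b) ⊗ c`, which turns `(Δ ⊗ id) R = R₁₃ R₂₃` into a formula for
the inverse of `R`. -/
noncomputable def mulAntipode (K H : Type*) [CommRing K] [Ring H] [HopfAlgebra K H] :
    H ⊗[K] (H ⊗[K] H) →ₗ[K] H ⊗[K] H :=
  (LinearMap.mul' K H ∘ₗ (HopfAlgebra.antipode K).lTensor H).rTensor H ∘ₗ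
    (TensorProduct.assoc K H H H).symm.toLinearMap

@[simp]
lemma mulAntipode_tmul (a b c : H) :
    mulAntipode K H (a ⊗ₜ (b ⊗ₜ c)) = (a * HopfAlgebra.antipode K b) ⊗ₜ c := by
  simp [mulAntipode]

lemma mulAntipode_assoc_rTensor_comul (t : H ⊗[K] H) :
    mulAntipode K H (TensorProduct.assoc K H H H (Coalgebra.comul.rTensor H t)) =
      1 ⊗ₜ TensorProduct.lid K H (Coalgebra.counit.rTensor H t) := by
  induction t with
  | zero => simp
  | add s t hs ht => simp only [map_add, hs, ht, TensorProduct.tmul_add]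
  | tmul a b =>
    have hfold := HopfAlgebra.mul_antipode_lTensor_comul_apply (R := K) a
    simp only [mulAntipode, LinearMap.comp_apply, LinearEquiv.coe_coe,
      LinearEquiv.symm_apply_apply, LinearMap.rTensor_tmul, hfold, TensorProduct.lid_tmul,
      Algebra.algebraMap_eq_smul_one, TensorProduct.smul_tmul]

lemma mulAntipode_lTensor_includeRight_mul (s t : H ⊗[K] H) :
    mulAntipode K H
        ((Algebra.TensorProduct.includeRight (R := K) (A := H) (B := H)).toLinearMap.lTensor H s *
          (1 : H) ⊗ₜ[K] t) = s * (HopfAlgebra.antipode K).rTensor H t := by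
  induction s with
  | zero => simp
  | add s s' hs hs' => simp only [map_add, add_mul, hs, hs']
  | tmul a b =>
    induction t with
    | zero => simp
    | add t t' ht ht' => simp only [map_add, mul_add, TensorProduct.tmul_add, ht, ht']
    | tmul c d => simp

end MulAntipode

section Positivity

variable {H ι : Type*} [Ring H] [HopfAlgebra ℂ H] {R : H ⊗[ℂ] H}

lemma IsQuasiTriangular.mul_rTensor_antipode (hR : IsQuasiTriangular R) :
    R * (HopfAlgebra.antipode ℂ).rTensor H R = 1 := by
  rw [← mulAntipode_lTensor_includeRight_mul, ← hR.comul_rTensor, mulAntipode_assoc_rTensor_comul,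
    hR.counit_rTensor, Algebra.TensorProduct.one_def]

lemma IsQuasiTriangular.rTensor_antipode_mul (hR : IsQuasiTriangular R) :
    (HopfAlgebra.antipode ℂ).rTensor H R * R = 1 :=
  hR.isUnit.mul_left_cancel <| by rw [← mul_assoc, hR.mul_rTensor_antipode, one_mul, mul_one]

lemma IsPositiveBasis.isPositive_rTensor_antipode [Finite ι] {b : Module.Basis ι ℂ H}
    (hb : IsPositiveBasis b) (hR : IsPositive b R) :
    IsPositive b ((HopfAlgebra.antipode ℂ).rTensor H R) := by
  classical
  have := Fintype.ofFinite ι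
  intro p q
  rw [← (b.tensorProduct b).sum_repr R]
  simp only [map_sum, map_smul, Finsupp.finsetSum_apply, Finsupp.smul_apply, smul_eq_mul]
  refine Finset.sum_nonneg fun s _ => _root_.mul_nonneg (hR _ _) ?_
  rw [Module.Basis.tensorProduct_apply, LinearMap.rTensor_tmul,
    Module.Basis.tensorProduct_repr_tmul_apply, Module.Basis.repr_self, smul_eq_mul]
  refine _root_.mul_nonneg ?_ (hb.antipode_nonneg _ _)
  rw [Finsupp.single_apply]
  split_ifs <;> simp

end Positivity

section Cocycle

/-- The first relation makes `u ↦ ∏ v, r u v` a homomorphism to the positive elements of `K`, hence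
trivial; taking the product of the second one over `c` then gives `r u d ^ |L| = 1`. -/
lemma eq_one_of_cocycle {K I L : Type*} [Field K] [LinearOrder K] [IsStrictOrderedRing K]
    [Group I] [Finite I] [Group L] [Finite L] {r : I → L → K} (hr : ∀ u v, 0 < r u v)
    {π : I → Equiv.Perm L} {σ : I → L → I} (hleft : ∀ c d v, r (c * d) v = r c v * r d (π c v))
    (hright : ∀ u c d, r u (c * d) = r u d * r (σ u d) c) (u : I) (v : L) : r u v = 1 := by
  have := Fintype.ofFinite I
  have := Fintype.ofFinite L
  have hpos (c : I) : 0 < ∏ v, r c v := Finset.prod_pos fun v _ => hr _ _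
  have hmul (c d : I) : ∏ v, r (c * d) v = (∏ v, r c v) * ∏ v, r d v := by
    simp only [hleft, Finset.prod_mul_distrib, Equiv.prod_comp]
  let prodHom : I →* K :=
    { toFun := fun c => ∏ v, r c v
      map_one' := mul_left_cancel₀ (hpos 1).ne' (by rw [← hmul, one_mul, mul_one])
      map_mul' := hmul }
  have hprod (c : I) : ∏ v, r c v = 1 :=
    (pow_eq_one_iff_of_nonneg (hpos c).le Fintype.card_ne_zero).1
      (show prodHom c ^ Fintype.card I = 1 by rw [← map_pow, pow_card_eq_one, map_one])
  have hshift : ∏ c, r u (c * v) = ∏ c, r u c := Equiv.prod_comp (Equiv.mulRight v) _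
  simp only [hright, Finset.prod_mul_distrib, hprod, Finset.prod_const, Finset.card_univ,
    mul_one] at hshift
  exact (pow_eq_one_iff_of_nonneg (hr u v).le Fintype.card_ne_zero).1 hshift

end Cocycle

section Classification

variable {I J : Type*} [Group I] [Group J]

/-- The relations satisfied by the components `A : I → I → J` and `ξ : I → J` of a positive
quasi-triangular structure `∑ e (u, A u v) ⊗ e (v, ξ u)`. The relation `braid` is
`v u = (u ◁ A u v) (v ◁ ξ u)`, which makes `u ⊗ v ↦ (u ◁ A u v) ⊗ (v ◁ ξ u)` a braiding. -/
structure IsBraiding (mp : MatchedPair I J) (A : I → I → J) (ξ : I →* J) : Prop where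
  map_mul (u c d : I) : A u (c * d) = A u d * A (mp.ract u (A u d)) c
  mul_map (c d v : I) : A (c * d) v = A d (mp.ract v (ξ c))
  braid (u v : I) : v * u = mp.ract u (A u v) * mp.ract v (ξ u)
  mul_right (u : I) (x : J) : ξ u * x = mp.lact u x * ξ (mp.ract u x)
  mul_left (v : I) (x : J) : A 1 v * mp.lact v x = x * A 1 (mp.ract v x)

variable {H : Type*} [Ring H] [HopfAlgebra ℂ H] [Fintype I] {mp : MatchedPair I J}
  {e : Module.Basis (I × J) ℂ H}

namespace IsBicrossedBasis

variable (he : IsBicrossedBasis mp e)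
include he

lemma exists_eq_arrowSum [Finite J] (hb : IsPositiveBasis e) {R : H ⊗[ℂ] H}
    (hR : IsQuasiTriangular R) (hpos : IsPositive e R) :
    ∃ (r : I × I → ℝ) (f : I × I → J × J), (∀ p, 0 < r p) ∧
      R = arrowSum (arrowTensor e e) (fun p => (r p : ℂ)) f := by
  have repr_nonneg {t : H ⊗[ℂ] H} (ht : IsPositive e t) (p : (I × I) × J × J) :
      0 ≤ (arrowTensor e e).repr t p := (arrowTensor_repr t p.1 p.2).symm ▸ ht _ _
  obtain ⟨r, f, hr, hRf⟩ := he.isGroupoidBasis₂.exists_eq_arrowSum_of_mul_eq_one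
    (repr_nonneg hpos) (repr_nonneg (hb.isPositive_rTensor_antipode hpos))
    hR.mul_rTensor_antipode hR.rTensor_antipode_mul
  choose s hs hsr using fun p => RCLike.pos_iff_exists_ofReal.1 (hr p)
  exact ⟨s, f, hs, hRf.trans (congrArg (arrowSum _ · f) (funext fun p => (hsr p).symm))⟩

section Relations

variable {r : I × I → ℂ} {f : I × I → J × J}
  (hR : IsQuasiTriangular (arrowSum (arrowTensor e e) r f))
include hR

lemma relation_mul_right (u c d : I) :
    r (u, c * d) = r (u, d) * r (mp.ract u (f (u, d)).1, c) ∧ (r (u, c * d) ≠ 0 →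
      (f (u, c * d)).1 = (f (u, d)).1 * (f (mp.ract u (f (u, d)).1, c)).1 ∧
      (f (u, c * d)).2 = (f (u, d)).2) := by
  have h := hR.comul_lTensor
  rw [he.lTensor_comul_arrowSum, he.lTensor_includeRight_arrowSum, he.assoc_arrowSum_tmul_one,
    he.isGroupoidBasis₃.arrowSum_mul_arrowSum] at h
  obtain ⟨hr, hf⟩ := eq_and_eq_of_arrowSum_eq h (u, c, d)
  simp only [mp.ract_one, one_mul, mul_one, Prod.ext_iff, Prod.fst_mul, Prod.snd_mul] at hr hf
  exact ⟨hr, fun h0 => ⟨(hf h0).1, (hf h0).2.2⟩⟩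

lemma relation_mul_left (c d v : I) :
    r (c * d, v) = r (c, v) * r (d, mp.ract v (f (c, v)).2) ∧ (r (c * d, v) ≠ 0 →
      (f (c * d, v)).1 = (f (d, mp.ract v (f (c, v)).2)).1 ∧
      (f (c * d, v)).2 = (f (c, v)).2 * (f (d, mp.ract v (f (c, v)).2)).2) := by
  have h := hR.comul_rTensor
  rw [he.rTensor_comul_arrowSum, he.lTensor_includeRight_arrowSum, he.one_tmul_arrowSum,
    he.isGroupoidBasis₃.arrowSum_mul_arrowSum] at h
  obtain ⟨hr, hf⟩ := eq_and_eq_of_arrowSum_eq h (c, d, v)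
  simp only [mp.ract_one, one_mul, mul_one, Prod.ext_iff, Prod.fst_mul, Prod.snd_mul] at hr hf
  exact ⟨hr, fun h0 => (hf h0).2⟩

omit hR in
lemma relation_comm {f : I × I → J × J}
    (hR : IsQuasiTriangular (arrowSum (arrowTensor e e) 1 f)) (u v : I) (x : J) :
    v * u = mp.ract u (f (u, v)).1 * mp.ract v (f (u, v)).2 ∧
      x * (f (mp.ract u x, mp.ract v (mp.lact u x))).1 =
        (f (u, v)).1 * mp.lact (mp.ract v (f (u, v)).2) x ∧
      mp.lact u x * (f (mp.ract u x, mp.ract v (mp.lact u x))).2 = (f (u, v)).2 * x := by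
  classical
  have h := hR.comm_comul (e (v * u, x))
  rw [he.comul_eq_arrowSum, comm_arrowSum, he.isGroupoidBasis₂.arrowSum_mul_arrowSum,
    he.isGroupoidBasis₂.arrowSum_mul_arrowSum] at h
  obtain ⟨hr, hf⟩ := eq_and_eq_of_arrowSum_eq h (u, v)
  simp only [Pi.one_apply, if_true, mul_one, one_mul, ne_eq,
    one_ne_zero, not_false_eq_true, true_imp_iff, Prod.ext_iff, Prod.fst_mul, Prod.snd_mul,
    Prod.swap_prod_mk] at hr hf
  exact ⟨by_contra fun hne => one_ne_zero (hr.trans (if_neg (Ne.symm hne))), hf⟩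

lemma coeff_eq_one [Finite J] {s : I × I → ℝ} (hs : ∀ p, 0 < s p) (hrs : ∀ p, r p = s p)
    (p : I × I) : r p = 1 := by
  have hne (q : I × I) : r q ≠ 0 := by
    rw [hrs]
    exact_mod_cast (hs q).ne'
  have hsnd (u v : I) : (f (u, v)).2 = (f (u, 1)).2 := by
    simpa using ((he.relation_mul_right hR u v 1).2 (hne _)).2
  rw [hrs, Complex.ofReal_eq_one]
  refine eq_one_of_cocycle (r := fun u v => s (u, v)) (fun _ _ => hs _)
    (π := fun u => mp.ractEquiv (f (u, 1)).2) (σ := fun u v => mp.ract u (f (u, v)).1)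
    (fun c d v => ?_) (fun u c d => ?_) p.1 p.2
  · have h := (he.relation_mul_left hR c d v).1
    rw [hrs, hrs, hrs, hsnd] at h
    exact_mod_cast h
  · have h := (he.relation_mul_right hR u c d).1
    rw [hrs, hrs, hrs] at h
    exact_mod_cast h

end Relations

lemma exists_isBraiding [Finite J] (hb : IsPositiveBasis e) {R : H ⊗[ℂ] H}
    (hR : IsQuasiTriangular R) (hpos : IsPositive e R) :
    ∃ (A : I → I → J) (ξ : I →* J), IsBraiding mp A ξ ∧
      R = arrowSum (arrowTensor e e) 1 (fun p => (A p.1 p.2, ξ p.1)) := by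
  obtain ⟨r, f, hr, rfl⟩ := he.exists_eq_arrowSum hb hR hpos
  have hone : arrowSum (arrowTensor e e) (fun p => (r p : ℂ)) f = arrowSum (arrowTensor e e) 1 f :=
    arrowSum_congr (he.coeff_eq_one hR hr fun _ => rfl) fun _ _ => rfl
  rw [hone] at hR ⊢
  have hright (u c d : I) := (he.relation_mul_right hR u c d).2 one_ne_zero
  have hleft (c d v : I) := (he.relation_mul_left hR c d v).2 one_ne_zero
  have hsnd (u v : I) : (f (u, v)).2 = (f (u, 1)).2 := by simpa using (hright u v 1).2
  let ξ : I →* J := MonoidHom.mk' (fun u => (f (u, 1)).2) fun c d => by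
    rw [(hleft c d 1).2, hsnd d]
  have hf (u v : I) : (f (u, v)).2 = ξ u := hsnd u v
  refine ⟨fun u v => (f (u, v)).1, ξ, ⟨fun u c d => (hright u c d).1, fun c d v => ?_,
    fun u v => ?_, fun u x => ?_, fun v x => ?_⟩, arrowSum_congr (fun _ => rfl) fun p _ =>
      Prod.ext rfl (hf p.1 p.2)⟩
  · rw [← hf c v]
    exact (hleft c d v).1
  · rw [← hf u v]
    exact (he.relation_comm hR u v 1).1
  · simpa only [hf] using (he.relation_comm hR u 1 x).2.2.symm
  · have h := (he.relation_comm hR 1 v x).2.1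
    rw [hf, mp.one_ract, mp.one_lact, map_one, mp.ract_one] at h
    exact h.symm

end IsBicrossedBasis

end Classification

section Product

namespace MatchedPair

variable {I J : Type*} [Group I] [Group J]

/-- The group `J I` factorized by a matched pair; `⟨x, i⟩` stands for `x i`. -/
@[ext]
structure Product (mp : MatchedPair I J) where
  fst : J
  snd : I

variable {mp : MatchedPair I J}

namespace Product

instance [Finite I] [Finite J] : Finite mp.Product :=
  Finite.of_injective (fun g => (g.fst, g.snd)) fun _ _ h =>
    Product.ext (congrArg Prod.fst h) (congrArg Prod.snd h)

instance : Mul mp.Product :=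
  ⟨fun g k => ⟨g.fst * mp.lact g.snd k.fst, mp.ract g.snd k.fst * k.snd⟩⟩

instance : One mp.Product := ⟨⟨1, 1⟩⟩

instance : Inv mp.Product :=
  ⟨fun g => ⟨mp.lact g.snd⁻¹ g.fst⁻¹, mp.ract g.snd⁻¹ g.fst⁻¹⟩⟩

@[simp]
lemma fst_mul (g k : mp.Product) : (g * k).fst = g.fst * mp.lact g.snd k.fst := rfl

@[simp]
lemma snd_mul (g k : mp.Product) : (g * k).snd = mp.ract g.snd k.fst * k.snd := rfl

@[simp]
lemma fst_one : (1 : mp.Product).fst = 1 := rfl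

@[simp]
lemma snd_one : (1 : mp.Product).snd = 1 := rfl

@[simp]
lemma fst_inv (g : mp.Product) : g⁻¹.fst = mp.lact g.snd⁻¹ g.fst⁻¹ := rfl

@[simp]
lemma snd_inv (g : mp.Product) : g⁻¹.snd = mp.ract g.snd⁻¹ g.fst⁻¹ := rfl

instance : Group mp.Product := Group.ofLeftAxioms
  (fun g k l => by ext <;> simp [mp.mul_lact, mp.lact_mul, mp.mul_ract, mp.ract_mul, mul_assoc])
  (fun g => by ext <;> simp [mp.one_lact, mp.one_ract])
  (fun g => by
    ext
    · simp [← mp.lact_mul, mp.lact_one]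
    · simp [← mp.ract_mul, mp.ract_one])

end Product

variable (mp) in
/-- The inclusion of `I` in the product group. -/
def inl : I →* mp.Product := MonoidHom.mk' (fun i => ⟨1, i⟩) fun i j => by
  ext <;> simp [mp.lact_one, mp.ract_one]

variable (mp) in
/-- The inclusion of `J` in the product group. -/
def inr : J →* mp.Product := MonoidHom.mk' (fun x => ⟨x, 1⟩) fun x y => by
  ext <;> simp [mp.one_lact, mp.one_ract]

@[simp]
lemma fst_inl (i : I) : (mp.inl i).fst = 1 := rfl

@[simp]
lemma snd_inl (i : I) : (mp.inl i).snd = i := rfl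

@[simp]
lemma fst_inr (x : J) : (mp.inr x).fst = x := rfl

@[simp]
lemma snd_inr (x : J) : (mp.inr x).snd = 1 := rfl

lemma inr_mul_inl (x : J) (i : I) : mp.inr x * mp.inl i = ⟨x, i⟩ := by
  ext <;> simp [mp.lact_one, mp.ract_one]

lemma inl_mul_inr (i : I) (x : J) :
    mp.inl i * mp.inr x = mp.inr (mp.lact i x) * mp.inl (mp.ract i x) := by
  rw [inr_mul_inl]
  ext <;> simp

lemma inr_injective : Function.Injective mp.inr := fun _ _ h => congrArg Product.fst h

/-- The retraction of the product group onto `J` which extends a homomorphism `ξ : I →* J` with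
`ξ i * x = (i ▷ x) * ξ (i ◁ x)`. -/
def retraction (ξ : I →* J) (hξ : ∀ i x, ξ i * x = mp.lact i x * ξ (mp.ract i x)) :
    mp.Product →* J := MonoidHom.mk' (fun g => g.fst * ξ g.snd) fun g k => by
  rw [Product.fst_mul, Product.snd_mul, map_mul, mul_assoc, ← mul_assoc (mp.lact _ _), ← hξ]
  simp only [mul_assoc]

section Graph

variable (ξ : I →* J)

section

variable (hξ : ∀ i x, ξ i * x = mp.lact i x * ξ (mp.ract i x))

@[simp]
lemma retraction_inl (i : I) : retraction ξ hξ (mp.inl i) = ξ i := one_mul _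

@[simp]
lemma retraction_inr (x : J) : retraction ξ hξ (mp.inr x) = x := by
  change x * ξ 1 = x
  rw [map_one, mul_one]

end

variable (mp) in
/-- The element `(ξ i)⁻¹ i` of the product group. -/
def graph (i : I) : mp.Product := mp.inr (ξ i)⁻¹ * mp.inl i

variable (hξ : ∀ i x, ξ i * x = mp.lact i x * ξ (mp.ract i x))

/-- The parametrization of the kernel of the retraction by `I`. -/
def graphEquiv : I ≃ (retraction ξ hξ).ker where
  toFun i := ⟨mp.graph ξ i, by simp [MonoidHom.mem_ker, graph]⟩
  invFun g := g.1.snd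
  left_inv i := by
    dsimp only [graph]
    rw [inr_mul_inl]
  right_inv g := by
    obtain ⟨⟨x, i⟩, hg⟩ := g
    have hx : x * ξ i = 1 := hg
    apply Subtype.ext
    dsimp only [graph]
    rw [inr_mul_inl, eq_inv_of_mul_eq_one_left hx]

variable {ξ}
include hξ

lemma graph_ract (i : I) (x : J) :
    mp.graph ξ (mp.ract i x) = (mp.inr x)⁻¹ * mp.graph ξ i * mp.inr x := by
  rw [graph, graph, mul_assoc, mul_assoc, inl_mul_inr, ← mul_assoc, ← mul_assoc, ← map_inv mp.inr,
    ← map_mul mp.inr, ← map_mul mp.inr]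
  congr 2
  rw [eq_mul_inv_of_mul_eq (hξ i x).symm]
  group

lemma graph_mul (i j : I) :
    mp.graph ξ i * mp.graph ξ j = mp.graph ξ (mp.ract i (ξ j)⁻¹ * j) := by
  have hcomm :
      mp.graph ξ i * mp.inr (ξ j)⁻¹ = mp.inr (ξ j)⁻¹ * mp.graph ξ (mp.ract i (ξ j)⁻¹) := by
    rw [graph_ract hξ]
    group
  rw [graph.eq_1 mp ξ j, ← mul_assoc, hcomm, graph, graph, map_mul, map_mul, mul_inv_rev, map_mul]
  simp only [mul_assoc]

end Graph

end MatchedPair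

lemma isComplement_ker_range {G J : Type*} [Group G] [Group J] (ρ : G →* J) (s : J →* G)
    (h : ∀ x, ρ (s x) = x) : ρ.ker.IsComplement' s.range := by
  refine Subgroup.isComplement'_of_disjoint_and_mul_eq_univ ?_ ?_
  · rw [Subgroup.disjoint_def]
    rintro _ hx ⟨x, rfl⟩
    rw [MonoidHom.mem_ker, h] at hx
    rw [hx, map_one]
  · refine Set.eq_univ_of_forall fun g => ⟨g * (s (ρ g))⁻¹, ?_, s (ρ g), ⟨_, rfl⟩, by group⟩
    simp [MonoidHom.mem_ker, h]

end Product

section Semidirect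

variable {G : Type*} [Group G] {P N : Subgroup G} (hPN : P.IsComplement' N) [hP : P.Normal]

variable (P N) in
/-- The matched pair of a factorization `G = P N` with `P` normal: `N` acts on `P` by conjugation
and `P` acts trivially on `N`. -/
def semidirectPair : MatchedPair P N where
  ract u x := ⟨(x : G)⁻¹ * u * x, hP.conj_mem' _ u.2 _⟩
  lact _ x := x
  ract_one u := by simp
  ract_mul u x y := by ext; simp [mul_assoc]
  mul_ract u v x := by ext; simp [mul_assoc]
  one_lact _ := rfl
  mul_lact _ _ _ := rfl
  lact_mul _ _ _ := rfl

@[simp]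
lemma coe_semidirectPair_ract (u : P) (x : N) :
    ((semidirectPair P N).ract u x : G) = (x : G)⁻¹ * u * x := rfl

@[simp]
lemma semidirectPair_lact (u : P) (x : N) : (semidirectPair P N).lact u x = x := rfl

lemma barPlus_mul_of_normal {u x : G} (hu : u ∈ P) (hx : x ∈ N) :
    barPlus hPN (u * x) = x⁻¹ * u * x := by
  have h : u * x = x * (x⁻¹ * u * x) := by group
  rw [h, barPlus_of_mem_mul hPN hx, barPlus_of_mem hPN (hP.conj_mem' _ hu _)]

lemma minus_mul_of_normal {u x : G} (hu : u ∈ P) (hx : x ∈ N) : minus hPN (x * u) = x := by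
  rw [← inv_mul_cancel_right (x * u) x]
  exact (plus_minus_unique hPN (hP.conj_mem _ hu _) hx).2

namespace BicrossedHopf

/-- The standard basis of `H(G; P, N)`, indexed by `P × N` through the factorization. -/
noncomputable def pairBasis : Module.Basis (P × N) ℂ (BicrossedHopf hPN) :=
  (basis hPN).reindex (Subgroup.IsComplement.equiv hPN)

omit hP in
lemma pairBasis_apply (u : P) (x : N) : pairBasis hPN (u, x) = of hPN (u * x) := by
  rw [pairBasis, Module.Basis.reindex_apply]
  rfl

lemma isBicrossedBasis_pairBasis [Fintype G] [Fintype P] :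
    IsBicrossedBasis (semidirectPair P N) (pairBasis hPN) where
  mul_eq_ite u v x y _ := by
    classical
    simp only [pairBasis_apply, of_mul_of, barPlus_mul_of_normal hPN u.2 x.2,
      (plus_minus_unique hPN v.2 y.2).1, (plus_minus_unique hPN v.2 y.2).2, Subtype.ext_iff,
      coe_semidirectPair_ract, Subgroup.coe_mul, mul_assoc]
  comul u x := by
    simp only [pairBasis_apply, comul_of, (plus_minus_unique hPN u.2 x.2).2]
    refine Finset.sum_congr (by ext; simp) fun h _ => ?_
    rw [barPlus_mul_of_normal hPN h.2 x.2]
    congr 2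
    rw [semidirectPair_lact]
    push_cast
    group

end BicrossedHopf

end Semidirect

section TwistElement

variable {K H I J : Type*} [CommRing K] [Ring H] [HopfAlgebra K H] [Group I] [Group J] [Fintype I]
  {mp : MatchedPair I J} {e : Module.Basis (I × J) K H}

namespace IsBicrossedBasis

variable (he : IsBicrossedBasis mp e)

/-- The elements `∑ e(u, ζ(v)) ⊗ e(v, 1)`, the sum being over `u` and `v`. Both the twists and the
normal quasi-triangular structures have this form. -/
noncomputable def twist : (I → J) →* H ⊗[K] H where
  toFun ζ := arrowSum (arrowTensor e e) 1 fun p => (ζ p.2, 1)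
  map_one' := he.isGroupoidBasis₂.one_eq_arrowSum.symm
  map_mul' ζ ζ' := by
    rw [he.isGroupoidBasis₂.arrowSum_mul_arrowSum]
    exact arrowSum_congr (fun _ => by simp) fun _ _ => by simp [mp.ract_one]

lemma twist_apply (ζ : I → J) :
    he.twist ζ = arrowSum (arrowTensor e e) 1 fun p => (ζ p.2, 1) := rfl

end IsBicrossedBasis

end TwistElement

section NormalTwist

variable {H I J : Type*} [Ring H] [HopfAlgebra ℂ H] [Group I] [Group J] [Fintype I]
  {mp : MatchedPair I J} {e : Module.Basis (I × J) ℂ H}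

lemma IsBicrossedBasis.isQuasiTriangular_twist (he : IsBicrossedBasis mp e)
    (hlact : ∀ u x, mp.lact u x = x) (η : I →* J) (hη : ∀ v x, x * η (mp.ract v x) = η v * x)
    (hpeiffer : ∀ u v, mp.ract u (η v)⁻¹ * v = v * u) :
    IsQuasiTriangular (he.twist fun v => (η v)⁻¹) where
  isUnit := (Group.isUnit _).map he.twist
  comm_comul a := by
    classical
    have hbasis : (LinearMap.mulRight ℂ (he.twist fun v => (η v)⁻¹)) ∘ₗ
        (TensorProduct.comm ℂ H H).toLinearMap ∘ₗ Coalgebra.comul =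
        LinearMap.mulLeft ℂ (he.twist fun v => (η v)⁻¹) ∘ₗ Coalgebra.comul := by
      refine e.ext fun ⟨w, x⟩ => ?_
      simp only [LinearMap.comp_apply, LinearMap.mulRight_apply, LinearMap.mulLeft_apply,
        LinearEquiv.coe_coe, he.comul_eq_arrowSum, comm_arrowSum, twist_apply,
        he.isGroupoidBasis₂.arrowSum_mul_arrowSum]
      refine arrowSum_congr (fun p => by simp [mp.ract_one, hpeiffer]) fun p _ => ?_
      simp only [hlact, Prod.swap, Prod.mk_mul_mk, mul_one, one_mul, Prod.mk.injEq, and_true]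
      rw [mul_inv_eq_iff_eq_mul, mul_assoc, hη, inv_mul_cancel_left]
    exact LinearMap.congr_fun hbasis a
  comul_rTensor := by
    rw [twist_apply, he.rTensor_comul_arrowSum, he.lTensor_includeRight_arrowSum,
      he.one_tmul_arrowSum, he.isGroupoidBasis₃.arrowSum_mul_arrowSum]
    exact arrowSum_congr (fun _ => by simp) fun _ _ => by simp [hlact, mp.ract_one]
  comul_lTensor := by
    rw [twist_apply, he.lTensor_comul_arrowSum, he.lTensor_includeRight_arrowSum,
      he.assoc_arrowSum_tmul_one, he.isGroupoidBasis₃.arrowSum_mul_arrowSum]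
    exact arrowSum_congr (fun _ => by simp) fun _ _ => by simp [hlact, mp.ract_one]
  counit_rTensor := by
    rw [twist_apply, he.lid_rTensor_counit_arrowSum, he.isGroupoidBasis.one_eq_arrowSum]
    rfl
  counit_lTensor := by
    rw [twist_apply, he.rid_lTensor_counit_arrowSum, he.isGroupoidBasis.one_eq_arrowSum]
    exact arrowSum_congr (fun _ => rfl) fun _ _ => by simp

end NormalTwist

section Normality

lemma isPositive_arrowSum {H X M : Type*} [Ring H] [HopfAlgebra ℂ H] [Fintype X]
    {e : Module.Basis (X × M) ℂ H} {r : X × X → ℂ} (hr : ∀ p, 0 ≤ r p) (f : X × X → M × M) :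
    IsPositive e (arrowSum (arrowTensor e e) r f) := by
  classical
  rintro ⟨p, x⟩ ⟨q, y⟩
  rw [← arrowTensor_repr _ (p, q) (x, y), repr_arrowSum]
  split_ifs
  exacts [hr _, le_rfl]

variable {G : Type*} [Group G] {P N : Subgroup G} (hPN : P.IsComplement' N) (ρ : G →* N)
  (hρ : ∀ x : N, ρ x = x) (hcomm : ∀ u ∈ P, ∀ z ∈ ρ.ker, z * u = u * z)

/-- The isomorphism `u ↦ ρ(u) u⁻¹` of `P` onto the kernel of a retraction `ρ` onto a complement
`N` of `P`, when this kernel commutes with `P`. -/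
noncomputable def complementEquivKer : P ≃* ρ.ker where
  toFun u := ⟨ρ u * (u : G)⁻¹, by simp [MonoidHom.mem_ker, hρ]⟩
  invFun z := ⟨plus hPN (z : G)⁻¹, plus_mem hPN _⟩
  left_inv u := by
    ext
    change plus hPN ((ρ u : G) * (u : G)⁻¹)⁻¹ = u
    rw [mul_inv_rev, inv_inv]
    exact (plus_minus_unique hPN u.2 (N.inv_mem (ρ u).2)).1
  right_inv z := by
    ext
    have hz : (z : G)⁻¹ = plus hPN (z : G)⁻¹ * minus hPN (z : G)⁻¹ := (plus_mul_minus hPN _).symm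
    have hker : ρ (plus hPN (z : G)⁻¹) * ⟨minus hPN (z : G)⁻¹, minus_mem hPN _⟩ = 1 := by
      rw [← hρ ⟨minus hPN (z : G)⁻¹, _⟩, ← map_mul, ← hz]
      exact ρ.ker.inv_mem z.2
    change (ρ (plus hPN (z : G)⁻¹) : G) * (plus hPN (z : G)⁻¹)⁻¹ = z
    rw [eq_inv_of_mul_eq_one_left hker, Subgroup.coe_inv, ← mul_inv_rev, ← hz, inv_inv]
  map_mul' u v := by
    ext
    have hmem : (ρ v : G) * (v : G)⁻¹ ∈ ρ.ker := by simp [MonoidHom.mem_ker, hρ]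
    have hcomm' := hcomm _ (P.inv_mem u.2) _ hmem
    change (ρ (u * v : G) : G) * (u * v : G)⁻¹ = ρ u * (u : G)⁻¹ * (ρ v * (v : G)⁻¹)
    rw [mul_assoc (ρ u : G), ← hcomm', map_mul, Subgroup.coe_mul, mul_inv_rev]
    simp only [mul_assoc]

lemma coe_complementEquivKer (u : P) :
    (complementEquivKer hPN ρ hρ hcomm u : G) = ρ u * (u : G)⁻¹ := rfl

variable [hP : P.Normal]

include hPN hρ hcomm in
lemma isAdmissible_one_restrict : IsAdmissible (1 : P →* N) (ρ.comp P.subtype) := by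
  refine ⟨P, ρ.ker, ?_, ?_, hP, inferInstance, complementEquivKer hPN ρ hρ hcomm, ?_⟩
  · ext g
    simp
  · have hrange := (complementEquivKer hPN ρ hρ hcomm).surjective.comp (Equiv.inv P).surjective
    rw [← Subtype.range_coe (s := (ρ.ker : Set G)), ← hrange.range_comp]
    congr! 2 with u
    simp only [Function.comp_apply, Equiv.inv_apply, coe_complementEquivKer, Subgroup.coe_inv,
      inv_inv, MonoidHom.comp_apply, Subgroup.subtype_apply]
  · intro u a hau
    obtain rfl : a = u := Subtype.ext (by simpa using hau)
    rfl

variable [Fintype G] [Fintype P]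

lemma rMatrix_one_restrict : rMatrix hPN 1 (ρ.comp P.subtype) =
    (BicrossedHopf.isBicrossedBasis_pairBasis hPN).twist (fun v => (ρ v)⁻¹) := by
  rw [rMatrix, IsBicrossedBasis.twist_apply, arrowSum, Fintype.sum_prod_type]
  refine Finset.sum_congr (by ext; simp) fun u _ => Finset.sum_congr (by ext; simp) fun v _ => ?_
  simp [BicrossedHopf.pairBasis_apply, minus_mul_of_normal hPN u.2 (SetLike.coe_mem _)]

lemma isPositive_basis_twist (ζ : P → N) : IsPositive (BicrossedHopf.basis hPN)
    ((BicrossedHopf.isBicrossedBasis_pairBasis hPN).twist ζ) := by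
  refine (isPositive_arrowSum (fun _ => zero_le_one) _).of_isRescaling
    (b := BicrossedHopf.pairBasis hPN) ⟨Subgroup.IsComplement.equiv hPN, 1, fun _ => one_pos, ?_⟩
  simp [BicrossedHopf.pairBasis]

include hρ hcomm in
lemma isNormal_twist : IsNormal hPN
    ((BicrossedHopf.isBicrossedBasis_pairBasis hPN).twist fun v => (ρ v)⁻¹) := by
  refine ⟨(BicrossedHopf.isBicrossedBasis_pairBasis hPN).isQuasiTriangular_twist
      semidirectPair_lact (ρ.comp P.subtype) ?_ ?_,
    isPositive_basis_twist hPN _, 1, _, isAdmissible_one_restrict hPN ρ hρ hcomm,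
    (rMatrix_one_restrict hPN ρ).symm, fun _ => rfl⟩
  · intro v x
    simp [hρ, mul_assoc]
  · intro u v
    have hmem : (ρ v : G)⁻¹ * v ∈ ρ.ker := by simp [MonoidHom.mem_ker, hρ]
    have hcomm' := hcomm u u.2 _ hmem
    ext
    simp only [Subgroup.coe_mul, coe_semidirectPair_ract, MonoidHom.comp_apply,
      Subgroup.subtype_apply, Subgroup.coe_inv, inv_inv]
    rw [mul_assoc, mul_assoc, ← hcomm', mul_assoc, mul_inv_cancel_left]

end Normality

section Reindex

variable {K X Y M N A B : Type*} [CommRing K] [Ring A] [Algebra K A] [Ring B] [Algebra K B]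

lemma arrowSum_eq_arrowSum_reindex [Fintype X] [Fintype Y] (E : Module.Basis (X × M) K A)
    (α : Y ≃ X) (β : N ≃ M) (r : X → K) {f : X → M} {g : Y → N} (h : ∀ p, f (α p) = β (g p)) :
    arrowSum E r f = arrowSum (E.reindex (α.prodCongr β).symm) (r ∘ α) g :=
  (Fintype.sum_equiv α _ _ fun p => by simp [h]).symm

lemma arrowTensor_reindex {X' Y' M' N' : Type*} (E : Module.Basis (X × M) K A)
    (F : Module.Basis (X' × M') K B) (α : Y ≃ X) (β : N ≃ M) (α' : Y' ≃ X') (β' : N' ≃ M') :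
    arrowTensor (E.reindex (α.prodCongr β).symm) (F.reindex (α'.prodCongr β').symm) =
      (arrowTensor E F).reindex ((α.prodCongr α').prodCongr (β.prodCongr β')).symm :=
  Module.Basis.eq_of_apply_eq fun ⟨p, x⟩ => by
    rw [arrowTensor_apply, Module.Basis.reindex_apply]
    simp

namespace IsGroupoidBasis

lemma reindex [Monoid M] [Monoid N] {act : X → M → X} {act' : Y → N → Y}
    {E : Module.Basis (X × M) K A} (hE : IsGroupoidBasis act E) {α : Y ≃ X} {β : N ≃* M}
    (h : ∀ p x, act (α p) (β x) = α (act' p x)) :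
    IsGroupoidBasis act' (E.reindex (α.prodCongr β.toEquiv).symm) where
  act_one p := α.injective <| by rw [← h, map_one, hE.act_one]
  act_mul p x y := α.injective <| by rw [← h, ← h, ← h, map_mul, hE.act_mul]
  mul_eq_ite p q x y _ := by
    classical
    simp [hE.mul_eq_ite, h]

lemma exists_algEquiv [Monoid M] {act : X → M → X} {E : Module.Basis (X × M) K A}
    {F : Module.Basis (X × M) K B} (hE : IsGroupoidBasis act E) (hF : IsGroupoidBasis act F) :
    ∃ φ : A ≃ₐ[K] B, ∀ p, φ (E p) = F p := by
  classical
  let L := E.equiv F (Equiv.refl _)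
  have hL (p) : L (E p) = F p := by simp [L]
  have hbasis : (LinearMap.mul K A).compr₂ L.toLinearMap =
      (LinearMap.mul K B).compl₁₂ L.toLinearMap L.toLinearMap := by
    refine E.ext fun ⟨p, x⟩ => E.ext fun ⟨q, y⟩ => ?_
    simp only [LinearMap.compr₂_apply, LinearMap.compl₁₂_apply, LinearMap.mul_apply',
      LinearEquiv.coe_coe, hL, hE.mul_eq_ite, hF.mul_eq_ite, apply_ite L, map_zero]
  have hmul (a a' : A) : L (a * a') = L a * L a' := LinearMap.congr_fun₂ hbasis a a'
  have hone : L 1 = 1 := by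
    simpa using (hmul 1 (L.symm 1)).symm
  exact ⟨AlgEquiv.ofLinearEquiv L hone hmul, hL⟩

end IsGroupoidBasis

end Reindex

section Twisting

variable {I J : Type*} [Group I] [Group J] {mp : MatchedPair I J} {A : I → I → J} {ξ : I →* J}

namespace IsBraiding

variable (hB : IsBraiding mp A ξ)

/-- The homomorphism `v ↦ A(1, v)⁻¹` attached to a braiding. -/
def leftHom : I →* J :=
  MonoidHom.mk' (fun v => (A 1 v)⁻¹) fun c d => by
    rw [hB.map_mul, mp.one_ract, mul_inv_rev]

lemma leftHom_apply (v : I) : hB.leftHom v = (A 1 v)⁻¹ := rfl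

lemma leftHom_mul (v : I) (x : J) :
    hB.leftHom v * x = mp.lact v x * hB.leftHom (mp.ract v x) := by
  rw [leftHom_apply, leftHom_apply, inv_mul_eq_iff_eq_mul, ← mul_assoc, hB.mul_left,
    mul_inv_cancel_right]

include hB in
lemma apply_ract_inv (a b : I) : A a (mp.ract b (ξ a)⁻¹) = (hB.leftHom b)⁻¹ := by
  have h := hB.mul_map a⁻¹ a b
  rw [inv_mul_cancel, map_inv] at h
  rw [leftHom_apply, inv_inv, h]

lemma ract_inv_mul (a b : I) :
    mp.ract b (ξ a)⁻¹ * a = mp.ract a (hB.leftHom b)⁻¹ * b := by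
  rw [hB.braid, hB.apply_ract_inv, mp.ract_inv_ract]

/-- The elements of the two kernels attached to the same `b` differ by an element of `J`, and both
the kernel of the first retraction and `J` act on that kernel in a known way. -/
lemma commute_ker {w z : mp.Product}
    (hw : w ∈ (MatchedPair.retraction ξ hB.mul_right).ker)
    (hz : z ∈ (MatchedPair.retraction hB.leftHom hB.leftHom_mul).ker) : z * w = w * z := by
  obtain ⟨b, hb⟩ := (MatchedPair.graphEquiv hB.leftHom hB.leftHom_mul).surjective ⟨z, hz⟩
  obtain ⟨a, ha⟩ := (MatchedPair.graphEquiv ξ hB.mul_right).surjective ⟨w, hw⟩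
  obtain rfl : mp.graph hB.leftHom b = z := congrArg Subtype.val hb
  obtain rfl : mp.graph ξ a = w := congrArg Subtype.val ha
  have hshift : mp.graph hB.leftHom b = mp.inr ((hB.leftHom b)⁻¹ * ξ b) * mp.graph ξ b := by
    rw [MatchedPair.graph, MatchedPair.graph, ← mul_assoc, ← _root_.map_mul,
      mul_inv_cancel_right]
  have hconj := MatchedPair.graph_ract hB.mul_right a ((hB.leftHom b)⁻¹ * ξ b)
  have hexchange : mp.graph ξ b * mp.graph ξ a =
      mp.graph ξ (mp.ract a ((hB.leftHom b)⁻¹ * ξ b)) * mp.graph ξ b := by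
    rw [MatchedPair.graph_mul hB.mul_right, MatchedPair.graph_mul hB.mul_right, hB.ract_inv_mul,
      ← mp.ract_mul, mul_inv_cancel_right]
  rw [hshift, mul_assoc, hexchange, hconj]
  group

end IsBraiding

variable {H : Type*} [Ring H] [HopfAlgebra ℂ H] [Fintype I] {e : Module.Basis (I × J) ℂ H}
  (he : IsBicrossedBasis mp e)

namespace IsBicrossedBasis

lemma twist_toHomUnits (ζ : I → J) : (he.twist.toHomUnits ζ : H ⊗[ℂ] H) = he.twist ζ := rfl

section Transport

variable {H' : Type*} [Ring H'] [HopfAlgebra ℂ H'] {f : Module.Basis (I × J) ℂ H'}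
  [DecidableEq I] (hξ : ∀ i x, ξ i * x = mp.lact i x * ξ (mp.ract i x)) {φ : H' ≃ₐ[ℂ] H}
  (hφ : ∀ p, φ (f p) = e p)
  (hcomul : ∀ u x, Coalgebra.comul (R := ℂ) (f (u, x)) = arrowSum (arrowTensor f f)
    (fun p => if mp.ract p.1 (ξ p.2)⁻¹ * p.2 = u then 1 else 0) fun _ => (x, x))

include hξ hφ hcomul

lemma map_comul_mul_twist (a : H') :
    TensorProduct.map φ.toLinearMap φ.toLinearMap (Coalgebra.comul a) *
        he.twist (fun v => (ξ v)⁻¹) =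
      he.twist (fun v => (ξ v)⁻¹) * Coalgebra.comul (R := ℂ) (φ a) := by
  have hmap : ∀ p, TensorProduct.map φ.toLinearMap φ.toLinearMap (arrowTensor f f p) =
      arrowTensor e e p := fun ⟨p, x⟩ => by simp [hφ]
  have hbasis : LinearMap.mulRight ℂ (he.twist fun v => (ξ v)⁻¹) ∘ₗ
      TensorProduct.map φ.toLinearMap φ.toLinearMap ∘ₗ Coalgebra.comul =
      LinearMap.mulLeft ℂ (he.twist fun v => (ξ v)⁻¹) ∘ₗ Coalgebra.comul ∘ₗ φ.toLinearMap := by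
    refine f.ext fun ⟨u, x⟩ => ?_
    simp only [LinearMap.comp_apply, LinearMap.mulRight_apply, LinearMap.mulLeft_apply,
      AlgEquiv.toLinearMap_apply, hφ, hcomul, map_arrowSum hmap, he.comul_eq_arrowSum,
      twist_apply, he.isGroupoidBasis₂.arrowSum_mul_arrowSum]
    refine arrowSum_congr (fun p => by simp [mp.ract_one]) fun p _ => ?_
    simp only [Prod.mk_mul_mk, mp.ract_one, one_mul, mul_one, Prod.mk.injEq, and_true]
    rw [mul_inv_eq_iff_eq_mul, mul_assoc, ← hξ, inv_mul_cancel_left]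
  exact LinearMap.congr_fun hbasis a

lemma isQuasiIso_twist
    (hcounit : ∀ u x, Coalgebra.counit (R := ℂ) (f (u, x)) = if u = 1 then 1 else 0) :
    IsQuasiIso φ (he.twist.toHomUnits fun v => (ξ v)⁻¹) where
  counit_map a := by
    have hbasis : Coalgebra.counit ∘ₗ φ.toLinearMap = Coalgebra.counit (R := ℂ) (A := H') :=
      f.ext fun ⟨u, x⟩ => by simp [hφ, hcounit, he.counit_eq_ite]
    exact LinearMap.congr_fun hbasis a
  map_comul a := by
    rw [Units.eq_mul_inv_iff_mul_eq]
    exact he.map_comul_mul_twist hξ hφ hcomul a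
  cocycle := by
    rw [twist_toHomUnits, twist_apply, he.assoc_arrowSum_tmul_one, he.rTensor_comul_arrowSum,
      he.one_tmul_arrowSum, he.lTensor_comul_arrowSum, he.isGroupoidBasis₃.arrowSum_mul_arrowSum,
      he.isGroupoidBasis₃.arrowSum_mul_arrowSum]
    refine arrowSum_congr (fun _ => by simp) fun p _ => ?_
    simp only [Prod.mk_mul_mk, mp.lact_one, mp.ract_one, one_mul, mul_one, Prod.mk.injEq, and_true]
    rw [inv_mul_eq_iff_eq_mul, eq_comm, map_mul, mul_inv_rev, ← mul_assoc, mul_inv_eq_iff_eq_mul,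
      hξ]
  counit_rTensor := by
    rw [twist_toHomUnits, twist_apply, he.lid_rTensor_counit_arrowSum,
      he.isGroupoidBasis.one_eq_arrowSum]
    rfl
  counit_lTensor := by
    rw [twist_toHomUnits, twist_apply, he.rid_lTensor_counit_arrowSum,
      he.isGroupoidBasis.one_eq_arrowSum]
    exact arrowSum_congr (fun _ => rfl) fun _ _ => by simp

end Transport

lemma comm_twist_mul (hB : IsBraiding mp A ξ) :
    he.twist (fun v => (hB.leftHom v)⁻¹ * ξ v) =
      TensorProduct.comm ℂ H H (he.twist.toHomUnits fun v => (ξ v)⁻¹ : H ⊗[ℂ] H) *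
        arrowSum (arrowTensor e e) 1 (fun p => (A p.1 p.2, ξ p.1)) *
        (↑(he.twist.toHomUnits fun v => (ξ v)⁻¹)⁻¹ : H ⊗[ℂ] H) := by
  rw [Units.eq_mul_inv_iff_mul_eq, twist_toHomUnits, ← _root_.map_mul, twist_apply, twist_apply,
    comm_arrowSum, he.isGroupoidBasis₂.arrowSum_mul_arrowSum]
  refine arrowSum_congr (fun _ => by simp) fun p _ => ?_
  simp [mp.ract_one, hB.apply_ract_inv]

end IsBicrossedBasis

end Twisting

section GraphBasis

namespace MatchedPair

variable {I J : Type*} [Group I] [Group J] {mp : MatchedPair I J} {ξ : I →* J}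
  (hξ : ∀ i x, ξ i * x = mp.lact i x * ξ (mp.ract i x))

lemma isComplement_ker_retraction : (retraction ξ hξ).ker.IsComplement' mp.inr.range :=
  isComplement_ker_range _ _ (retraction_inr ξ hξ)

variable (mp) in
/-- The group `J` as a subgroup of the product group. -/
noncomputable def inrEquiv : J ≃* mp.inr.range := MonoidHom.ofInjective inr_injective

@[simp]
lemma coe_inrEquiv (x : J) : (mp.inrEquiv x : mp.Product) = mp.inr x := rfl

@[simp]
lemma coe_graphEquiv (i : I) : (graphEquiv ξ hξ i : mp.Product) = mp.graph ξ i := rfl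

lemma graphEquiv_one : graphEquiv ξ hξ 1 = 1 := by
  ext1
  simp [graph]

lemma graphEquiv_mul (i j : I) :
    graphEquiv ξ hξ i * graphEquiv ξ hξ j = graphEquiv ξ hξ (mp.ract i (ξ j)⁻¹ * j) :=
  Subtype.ext (graph_mul hξ i j)

lemma semidirectPair_ract_graphEquiv (i : I) (x : J) :
    (semidirectPair (retraction ξ hξ).ker mp.inr.range).ract (graphEquiv ξ hξ i)
      (mp.inrEquiv x) = graphEquiv ξ hξ (mp.ract i x) := by
  ext1
  simp [graph_ract hξ]

/-- The standard basis of the bicrossproduct of the product group, factorized by the kernel of the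
retraction and `J`, as a basis indexed by the arrows of the matched pair. -/
noncomputable def graphBasis :
    Module.Basis (I × J) ℂ (BicrossedHopf (isComplement_ker_retraction hξ)) :=
  (BicrossedHopf.pairBasis _).reindex ((graphEquiv ξ hξ).prodCongr mp.inrEquiv.toEquiv).symm

lemma graphBasis_apply (i : I) (x : J) :
    graphBasis hξ (i, x) = BicrossedHopf.pairBasis _ (graphEquiv ξ hξ i, mp.inrEquiv x) := by
  simp [graphBasis]

variable [Fintype mp.Product]

lemma arrowSum_arrowTensor_pairBasis [Fintype I] [Fintype (retraction ξ hξ).ker]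
    (r : (retraction ξ hξ).ker × (retraction ξ hξ).ker → ℂ)
    {f : (retraction ξ hξ).ker × (retraction ξ hξ).ker → mp.inr.range × mp.inr.range}
    {g : I × I → J × J} (h : ∀ p, f (p.map (graphEquiv ξ hξ) (graphEquiv ξ hξ)) =
      (g p).map mp.inrEquiv mp.inrEquiv) :
    arrowSum (arrowTensor (BicrossedHopf.pairBasis _) (BicrossedHopf.pairBasis _)) r f =
      arrowSum (arrowTensor (graphBasis hξ) (graphBasis hξ))
        (fun p => r (p.map (graphEquiv ξ hξ) (graphEquiv ξ hξ))) g := by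
  rw [graphBasis, arrowTensor_reindex]
  exact arrowSum_eq_arrowSum_reindex _ ((graphEquiv ξ hξ).prodCongr (graphEquiv ξ hξ))
    (mp.inrEquiv.toEquiv.prodCongr mp.inrEquiv.toEquiv) r h

lemma isGroupoidBasis_graphBasis : IsGroupoidBasis mp.ract (graphBasis hξ) := by
  have := Fintype.ofFinite (retraction ξ hξ).ker
  exact (BicrossedHopf.isBicrossedBasis_pairBasis _).isGroupoidBasis.reindex
    (semidirectPair_ract_graphEquiv hξ)

lemma twist_pairBasis [Fintype I] [Fintype (retraction ξ hξ).ker]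
    {σ : (retraction ξ hξ).ker → mp.inr.range} {ζ : I → J}
    (h : ∀ i, σ (graphEquiv ξ hξ i) = mp.inrEquiv (ζ i)) :
    (BicrossedHopf.isBicrossedBasis_pairBasis (isComplement_ker_retraction hξ)).twist σ =
      arrowSum (arrowTensor (graphBasis hξ) (graphBasis hξ)) 1 fun p => (ζ p.2, 1) :=
  arrowSum_arrowTensor_pairBasis hξ 1 fun p => by simp [h]

variable [DecidableEq I]

lemma counit_graphBasis (i : I) (x : J) :
    Coalgebra.counit (R := ℂ) (graphBasis hξ (i, x)) = if i = 1 then 1 else 0 := by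
  classical
  have := Fintype.ofFinite (retraction ξ hξ).ker
  rw [graphBasis_apply, (BicrossedHopf.isBicrossedBasis_pairBasis _).counit_eq_ite,
    ← graphEquiv_one hξ]
  simp only [EmbeddingLike.apply_eq_iff_eq]

lemma comul_graphBasis [Fintype I] (i : I) (x : J) :
    Coalgebra.comul (R := ℂ) (graphBasis hξ (i, x)) =
      arrowSum (arrowTensor (graphBasis hξ) (graphBasis hξ))
        (fun p => if mp.ract p.1 (ξ p.2)⁻¹ * p.2 = i then 1 else 0) fun _ => (x, x) := by
  classical
  have := Fintype.ofFinite (retraction ξ hξ).ker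
  rw [graphBasis_apply, (BicrossedHopf.isBicrossedBasis_pairBasis _).comul_eq_arrowSum,
    arrowSum_arrowTensor_pairBasis hξ _ (g := fun _ => (x, x)) fun _ => rfl]
  simp only [Prod.map_fst, Prod.map_snd, graphEquiv_mul, EmbeddingLike.apply_eq_iff_eq]

end MatchedPair

end GraphBasis

section Normalization

theorem IsBicrossedBasis.exists_isNormal {I J : Type} [Group I] [Group J] [Fintype I] [Finite J]
    {mp : MatchedPair I J} {A : I → I → J} {ξ : I →* J} {H : Type*} [Ring H] [HopfAlgebra ℂ H]
    {e : Module.Basis (I × J) ℂ H} (he : IsBicrossedBasis mp e) (hB : IsBraiding mp A ξ) :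
    ∃ (G : Type) (_ : Group G) (_ : Fintype G) (P N : Subgroup G) (hPN : P.IsComplement' N)
      (R' : BicrossedHopf hPN ⊗[ℂ] BicrossedHopf hPN), IsNormal hPN R' ∧
        QuasiIsomorphic R' (arrowSum (arrowTensor e e) 1 fun p => (A p.1 p.2, ξ p.1)) := by
  classical
  have := Fintype.ofFinite mp.Product
  have := Fintype.ofFinite (MatchedPair.retraction ξ hB.mul_right).ker
  let ρ := mp.inrEquiv.toMonoidHom.comp (MatchedPair.retraction hB.leftHom hB.leftHom_mul)
  have hρ (x : mp.inr.range) : ρ x = x := by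
    obtain ⟨x, rfl⟩ := mp.inrEquiv.surjective x
    simp [ρ]
  have hcomm : ∀ u ∈ (MatchedPair.retraction ξ hB.mul_right).ker, ∀ z ∈ ρ.ker, z * u = u * z := by
    intro u hu z hz
    refine hB.commute_ker hu ?_
    rwa [MonoidHom.mem_ker, MonoidHom.comp_apply, MulEquiv.coe_toMonoidHom,
      EmbeddingLike.map_eq_one_iff] at hz
  have hρgraph (i : I) : (ρ (mp.graph ξ i))⁻¹ = mp.inrEquiv ((hB.leftHom i)⁻¹ * ξ i) := by
    simp [ρ, MatchedPair.graph]
  obtain ⟨φ, hφ⟩ := (MatchedPair.isGroupoidBasis_graphBasis hB.mul_right).exists_algEquiv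
    he.isGroupoidBasis
  refine ⟨mp.Product, inferInstance, inferInstance, _, _, _, _, isNormal_twist
    (MatchedPair.isComplement_ker_retraction hB.mul_right) ρ hρ hcomm, φ, _,
    he.isQuasiIso_twist hB.mul_right hφ (MatchedPair.comul_graphBasis _)
      (MatchedPair.counit_graphBasis _), ?_⟩
  rw [← he.comm_twist_mul hB, MatchedPair.twist_pairBasis hB.mul_right hρgraph, he.twist_apply]
  exact map_arrowSum (fun ⟨p, x⟩ => by simp [hφ]) _ _

end Normalization

end PositiveHopf

theorem theorem3 {H : Type*} [Ring H] [HopfAlgebra ℂ H] {ι : Type*} [Finite ι]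
    (b : Module.Basis ι ℂ H) (hb : PositiveHopf.IsPositiveBasis b)
    (R : H ⊗[ℂ] H) (hR : PositiveHopf.IsQuasiTriangular R)
    (hRpos : PositiveHopf.IsPositive b R) :
    ∃ (G : Type) (_ : Group G) (_ : Fintype G) (P N : Subgroup G) (hPN : P.IsComplement' N)
      (R' : PositiveHopf.BicrossedHopf hPN ⊗[ℂ] PositiveHopf.BicrossedHopf hPN),
      PositiveHopf.IsNormal hPN R' ∧ PositiveHopf.QuasiIsomorphic R' R := by
  obtain ⟨I, J, _, _, _, _, mp, e, he, hbe⟩ := hb.exists_isBicrossedBasis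
  obtain ⟨A, ξ, hB, rfl⟩ := he.exists_isBraiding (hbe.isPositiveBasis hb) hR
    (hRpos.of_isRescaling hbe)
  exact he.exists_isNormal hB
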